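/- Let $n\ge 1$, let $h$ be the round metric of the unit sphere $S^n\subset\mathbb R^{n+1}$, and let $g_+=4(1-|y|^2)^{-2}\sum_i dy_i^2$ be the Poincaré metric of the open unit ball of $\mathbb R^{n+1}$. It satisfies $\mathrm{Ric}(g_+)+n\,g_+=0$, and in the collar coordinates $(0,2)\times S^n\ni(r,\theta)\mapsto y=\frac{2-r}{2+r}\,\theta$ it has the form $g_+=r^{-2}(dr^2+h_r)$ with $h_r=(1-r^2/4)^2h$; thus it is a Poincaré–Einstein metric with conformal infinity $[h]$, in normal form relative to $h$. Define the following objects. * The holographic coefficients $v_{2j}\in C^\infty(S^n)$ are the Taylor coefficients of $v(r)=\mathrm{vol}(h_r)/\mathrm{vol}(h)=v_0+v_2r^2+v_4r^4+\cdots$ as $r\to0+$. * For $N\ge1$ and $\lambda\in\mathbb C\setminus\{\frac n2-1,\dots,\frac n2-N\}$, the operators $\mathcal T_{2j}(\lambda)$, $0\le j\le N$, on $C^\infty(S^n)$ map $f$ to the coefficient $a_{2j}$ in the expansion $u=\sum_{k=0}^{2N}r^{\lambda+k}a_k$, $a_k\in C^\infty(S^n)$, $a_0=f$, which solves $\Delta_{g_+}u+\lambda(n-\lambda)u=O(r^{\lambda+2N+1})$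 as $r\to0+$, where $\Delta_{g_+}$ is the non-positive Laplace–Beltrami operator. * $\mathcal T^*_{2j}(\lambda)$ is the formal adjoint of $\mathcal T_{2j}(\lambda)$ with respect to the bilinear pairing $\int_{S^n}f\varphi\,\mathrm{vol}(h)$. These objects exist, and for all $N\ge1$ and all $\lambda\in\mathbb C\setminus\{\frac n2-1,\dots,\frac n2-N\}$, $$\sum_{j=0}^N\mathcal T_{2j}^*(\lambda)(v_{2N-2j})=(-1)^N\,\frac{(\frac n2-N+1)_N}{2^{2N}N!}\;\frac{(\lambda-n+2N)\,(\lambda-n+1)_{N-1}}{(\lambda-\frac n2+1)_N}$$ pointwise on $S^n$. Here $(x)_m=x(x+1)\cdots(x+m-1)$, $(x)_0=1$; in particular $(\frac n2-N+1)_N=\frac n2(\frac n2-1)\cdots(\frac n2-N+1)$. -/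

import Mathlib

noncomputable section

open scoped Manifold ContDiff Topology

namespace RoundSphere

/-! ### Riemannian metrics in the Cartesian coordinates of `ℝ^{n+1}` -/

/-- The Euclidean space `ℝ^{n+1}`. -/
abbrev Ambient (n : ℕ) : Type := EuclideanSpace ℝ (Fin (n + 1))

/-- A (field of) symmetric bilinear form(s), given by its components in Cartesian coordinates. -/
abbrev MetricField (n : ℕ) : Type := Ambient n → Matrix (Fin (n + 1)) (Fin (n + 1)) ℝ

/-- The partial derivative `∂_a u (y)`. -/
def pd {n : ℕ} {F : Type} [NormedAddCommGroup F] [NormedSpace ℝ F]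
    (a : Fin (n + 1)) (u : Ambient n → F) (y : Ambient n) : F :=
  fderiv ℝ u y (EuclideanSpace.single a 1)

/-- The Christoffel symbol
`Γ^c_{ab} = ½ ∑_d g^{cd} (∂_a g_{bd} + ∂_b g_{ad} - ∂_d g_{ab})`. -/
def christoffel {n : ℕ} (g : MetricField n) (c a b : Fin (n + 1)) (y : Ambient n) : ℝ :=
  (1 / 2) * ∑ d, (g y)⁻¹ c d *
    (pd a (fun z => g z b d) y + pd b (fun z => g z a d) y - pd d (fun z => g z a b) y)

/-- The Ricci tensor
`Ric_{ab} = ∂_c Γ^c_{ab} - ∂_b Γ^c_{ac} + Γ^c_{cd} Γ^d_{ab} - Γ^c_{bd} Γ^d_{ac}`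
(summation over repeated indices). -/
def ricci {n : ℕ} (g : MetricField n) (a b : Fin (n + 1)) (y : Ambient n) : ℝ :=
  ∑ c, (pd c (christoffel g c a b) y - pd b (christoffel g c a c) y) +
    ∑ c, ∑ d, (christoffel g c c d y * christoffel g d a b y -
      christoffel g c b d y * christoffel g d a c y)

/-- The (non-positive) Laplace-Beltrami operator
`Δ_g u = (det g)^{-1/2} ∑_a ∂_a ((det g)^{1/2} ∑_b g^{ab} ∂_b u)` on complex-valued functions. -/
def laplaceBeltrami {n : ℕ} (g : MetricField n) (u : Ambient n → ℂ) (y : Ambient n) : ℂ :=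
  ((Real.sqrt (g y).det : ℝ) : ℂ)⁻¹ *
    ∑ a, pd a (fun z => ∑ b, ((Real.sqrt (g z).det * (g z)⁻¹ a b : ℝ) : ℂ) * pd b u z) y

/-- The value `g_y(a, b)` of the metric on two tangent vectors. -/
def MetricField.apply {n : ℕ} (g : MetricField n) (y a b : Ambient n) : ℝ :=
  ∑ i, ∑ j, g y i j * a i * b j

/-! ### The Poincaré metric and its collar `S^n × (0, 2)` -/

/-- The Poincaré metric `4 (1 - |y|²)⁻² ∑ dy_i²` on the open unit ball of `ℝ^{n+1}`. -/
def poincareMetric (n : ℕ) : MetricField n :=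
  fun y => (4 / (1 - ‖y‖ ^ 2) ^ 2 : ℝ) • (1 : Matrix (Fin (n + 1)) (Fin (n + 1)) ℝ)

/-- The collar `(r, θ) ↦ (2 - r) / (2 + r) · θ`. It identifies `(0, 2) × S^n` with the
punctured open unit ball, and `r = 0` corresponds to the boundary sphere. -/
def collar (n : ℕ) (p : ℝ × Ambient n) : Ambient n := ((2 - p.1) / (2 + p.1)) • p.2

/-- The coordinate `r` of the collar as a function of the point `y` of the ball. -/
def collarRadius {n : ℕ} (y : Ambient n) : ℝ := 2 * (1 - ‖y‖) / (1 + ‖y‖)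

/-- The metric `h_r` on the slice: `h_r(a, b) = r² g_+(dΦ_r a, dΦ_r b)` for vectors `a`, `b`
tangent to `S^n` at `θ`, where `Φ_r` is the collar map at the fixed value `r`. -/
def sliceMetric (n : ℕ) (r : ℝ) (θ a b : Ambient n) : ℝ :=
  r ^ 2 * (poincareMetric n).apply (collar n (r, θ))
    (fderiv ℝ (fun z => collar n (r, z)) θ a) (fderiv ℝ (fun z => collar n (r, z)) θ b)

/-! ### Functions on the round sphere -/

instance finrankAmbient (n : ℕ) : Fact (Module.finrank ℝ (Ambient n) = n + 1) :=
  ⟨finrank_euclideanSpace_fin⟩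

/-- The unit sphere `S^n` in `ℝ^{n+1}`. -/
abbrev Sph (n : ℕ) : Type := Metric.sphere (0 : Ambient n) 1

/-- Smooth complex-valued functions on `S^n`. -/
abbrev SmoothFun (n : ℕ) : Type := C^∞⟮𝓡 n, Sph n; 𝓘(ℝ, ℂ), ℂ⟯

/-- The Riemannian measure of the round metric of `S^n`. -/
def sphereMeasure (n : ℕ) : MeasureTheory.Measure (Sph n) :=
  (MeasureTheory.volume : MeasureTheory.Measure (Ambient n)).toSphere

open Classical in
/-- The function `y ↦ f (y / |y|)` on `ℝ^{n+1} ∖ {0}`, with the value `0` at the origin. -/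
def radialExtension {n : ℕ} (f : Sph n → ℂ) (y : Ambient n) : ℂ :=
  if hy : y ≠ 0 then
    f ⟨‖y‖⁻¹ • y, by
      simp [norm_smul, inv_mul_cancel₀ (norm_ne_zero_iff.mpr hy)]⟩
  else 0

/-! ### Holographic coefficients -/

/-- `v(r) = vol(h_r) / vol(h)` at `θ ∈ S^n`, where `h` is the round metric: the square root of the
Gram determinant of `h_r` in an `h`-orthonormal basis of the tangent space `θ^⊥`. -/
def volumeRatio (n : ℕ) (r : ℝ) (θ : Sph n) : ℝ :=
  let e := stdOrthonormalBasis ℝ ↥(Submodule.span ℝ {(θ : Ambient n)})ᗮ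
  Real.sqrt (Matrix.of fun i j =>
    sliceMetric n r (θ : Ambient n) (e i : Ambient n) (e j : Ambient n)).det

/-- `v j` (for `j ≤ N`) is the holographic coefficient `v_{2j}`, i.e. pointwise on `S^n`
`v(r) = ∑_{j ≤ N} v_{2j} r^{2j} + O(r^{2N+1})` as `r → 0+`. -/
def IsHolographicCoefficients (n N : ℕ) (v : ℕ → SmoothFun n) : Prop :=
  ∀ θ : Sph n,
    (fun r : ℝ => ((volumeRatio n r θ : ℝ) : ℂ) -
      ∑ j ∈ Finset.range (N + 1), v j θ * ((r ^ (2 * j) : ℝ) : ℂ))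
      =O[𝓝[>] (0 : ℝ)] fun r : ℝ => r ^ (2 * N + 1)

/-! ### Asymptotic expansions of eigenfunctions -/

/-- The function `∑_{k ≤ K} r^{λ+k} a_k` on the collar. -/
def expansion {n : ℕ} (lam : ℂ) (K : ℕ) (a : ℕ → SmoothFun n) (y : Ambient n) : ℂ :=
  ∑ k ∈ Finset.range (K + 1),
    ((collarRadius y : ℝ) : ℂ) ^ (lam + (k : ℂ)) * radialExtension (a k) y

/-- `∑_k r^{λ+k} a_k` solves `-Δ_{g_+} u = λ (n - λ) u` up to the order `r^{λ+K}`: the function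
`u = ∑_{k ≤ K} r^{λ+k} a_k` satisfies `Δ_{g_+} u + λ (n - λ) u = O(r^{λ+K+1})` as `r → 0+`. -/
def IsFormalSolution {n : ℕ} (lam : ℂ) (K : ℕ) (a : ℕ → SmoothFun n) : Prop :=
  ∀ θ : Sph n,
    (fun r : ℝ =>
      laplaceBeltrami (poincareMetric n) (expansion lam K a) (collar n (r, (θ : Ambient n))) +
        lam * ((n : ℂ) - lam) * expansion lam K a (collar n (r, (θ : Ambient n))))
      =O[𝓝[>] (0 : ℝ)] fun r : ℝ => r ^ (lam.re + (K : ℝ) + 1)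

/-- `T j` (for `j ≤ N`) is the operator `T_{2j}(λ)` on `C^∞(S^n)`: it maps `f` to the coefficient
`a_{2j}` of the formal solution `∑_k r^{λ+k} a_k` with `a_0 = f`. -/
def IsSolutionOperators (n N : ℕ) (lam : ℂ) (T : ℕ → SmoothFun n → SmoothFun n) : Prop :=
  ∀ f : SmoothFun n, ∃ a : ℕ → SmoothFun n,
    a 0 = f ∧ IsFormalSolution lam (2 * N) a ∧ ∀ j ≤ N, T j f = a (2 * j)

/-- `B` is the formal adjoint of `A` with respect to the Riemannian measure of the round metric
(real structure: the pairing is bilinear). -/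
def IsFormalAdjoint {n : ℕ} (A B : SmoothFun n → SmoothFun n) : Prop :=
  ∀ f φ : SmoothFun n,
    ∫ θ, A f θ * φ θ ∂(sphereMeasure n) = ∫ θ, f θ * B φ θ ∂(sphereMeasure n)

end RoundSphere

end

/-! On the collar v(r) = (1 - r²/4)^n, and Δ_{g_+} + λ(n-λ) acts on r^κ f only through functions of
r and the sphere Laplacian Δ_h. Multiplied by (1 - r²/4)², it sends a finite expansion to r^λ times
a polynomial in r (`collar_term`, `expansion_equation`). The eigenvalue equation is therefore a
recursion expressing a_k by a_{k-2} and a_{k-4}, with leading factor k(2λ+k-n)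
(`isFormalSolution_iff`). For k = 2j ≥ 2 this factor vanishes exactly at λ = n/2 - j, so T_{2j}(λ)
is a well-defined polynomial in Δ_h. As Δ_h is formally self-adjoint
(`isFormalAdjoint_sphereLaplacian`) and formal adjoints are unique (`isFormalAdjoint_unique`),
T*_{2j}(λ) = T_{2j}(λ).

The holographic coefficients are constants, so the sum only sees T_{2j}(λ)(1). On constants the
recursion collapses to two terms and yields 4^{-j} times the j-th coefficient of F(n/2, λ; λ-n/2+1;
z), where z = r²/4 (`solutionOp_constFun`). The sum is thus 4^{-N} times the coefficient of z^N in
(1-z)^n F. Euler's transformation gives (1-z)^{n-1} F = F(λ-n+1, 1-n/2; λ-n/2+1; z), and the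
remaining factor 1-z takes the difference of two consecutive coefficients, which is the closed form
(`sum_hypergeometricCoeff`).

Self-adjointness of Δ_h is obtained in ℝ^{n+1}: the divergence theorem is applied to a radially
cut-off field built from degree-0 homogeneous extensions, and polar coordinates split off a nonzero
radial factor. -/

noncomputable section

open scoped Manifold ContDiff Topology

namespace RoundSphere

/-! ### Hypergeometric coefficients -/

/-- First-order recurrence for the Taylor coefficients of `(1 - z)^(a+b-c) F(a, b; c; z)`. -/
lemma eulerTransform_recurrence {K : Type*} [Field K] (a b c : K) (t w : ℕ → K) (N : ℕ)
    (ht : ∀ j ≤ N, ((j : K) + 1) * (c + j) * t (j + 1) = (a + j) * (b + j) * t j)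
    (hw : ∀ k ≤ N, ((k : K) + 1) * w (k + 1) = (c - a - b + k) * w k) :
    ((N : K) + 1) * (c + N) * ∑ j ∈ Finset.range (N + 2), t j * w (N + 1 - j) =
      (c - a + N) * (c - b + N) * ∑ j ∈ Finset.range (N + 1), t j * w (N - j) := by
  -- The summand is the forward difference in j of -j(c+j-1) t_j w_{N+1-j}, so partial sums
  -- telescope. At M = N+1 the boundary value is cancelled by the one extra term j = N+1 of the
  -- left-hand sum.
  have key : ∀ M ≤ N + 1, ∑ j ∈ Finset.range M,
      (((N : K) + 1) * (c + N) * (t j * w (N + 1 - j)) -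
        (c - a + N) * (c - b + N) * (t j * w (N - j))) =
      -((M : K) * (c + M - 1) * t M * w (N + 1 - M)) := by
    intro M
    induction M with
    | zero => simp
    | succ M ih =>
      intro hM
      obtain ⟨k, rfl⟩ : ∃ k, N = M + k := ⟨N - M, by omega⟩
      rw [Finset.sum_range_succ, ih (by omega)]
      have e1 : M + k + 1 - M = k + 1 := by omega
      have e2 : M + k - M = k := by omega
      have e3 : M + k + 1 - (M + 1) = k := by omega
      rw [e1, e2, e3]
      have h1 := ht M (by omega)
      have h2 := hw k (by omega)
      push_cast
      linear_combination w k * h1 + t M * (c + 2 * M + k) * h2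
  have h := key (N + 1) le_rfl
  rw [Finset.sum_sub_distrib, ← Finset.mul_sum, ← Finset.mul_sum] at h
  rw [Finset.sum_range_succ]
  have e0 : N + 1 - (N + 1) = 0 := by omega
  rw [e0] at h ⊢
  push_cast at h
  linear_combination h

/-- The coefficients of the hypergeometric series `F(n/2, lam; lam - n/2 + 1; z)`. -/
def hypergeometricCoeff (n : ℕ) (lam : ℂ) (j : ℕ) : ℂ :=
  (ascPochhammer ℂ j).eval ((n : ℂ) / 2) * (ascPochhammer ℂ j).eval lam /
    ((j.factorial : ℂ) * (ascPochhammer ℂ j).eval (lam - (n : ℂ) / 2 + 1))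

lemma ascPochhammer_eval_ne_zero {c : ℂ} {N : ℕ} (hc : ∀ j < N, c + j ≠ 0) :
    (ascPochhammer ℂ N).eval c ≠ 0 := by
  induction N with
  | zero => simp
  | succ N ih =>
    rw [ascPochhammer_succ_eval]
    exact mul_ne_zero (ih fun j hj => hc j (by omega)) (hc N (by omega))

lemma ascPochhammer_eval_succ_left (x : ℂ) (N : ℕ) :
    (ascPochhammer ℂ (N + 1)).eval x = x * (ascPochhammer ℂ N).eval (x + 1) := by
  simp [ascPochhammer_succ_left, Polynomial.eval_comp]

lemma hypergeometricCoeff_succ (n : ℕ) (lam : ℂ) (j : ℕ) (hj : lam - (n : ℂ) / 2 + 1 + j ≠ 0) :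
    ((j : ℂ) + 1) * (lam - (n : ℂ) / 2 + 1 + j) * hypergeometricCoeff n lam (j + 1) =
      ((n : ℂ) / 2 + j) * (lam + j) * hypergeometricCoeff n lam j := by
  have h1 : (j : ℂ) + 1 ≠ 0 := by exact_mod_cast Nat.succ_ne_zero j
  unfold hypergeometricCoeff
  simp only [ascPochhammer_succ_eval, Nat.factorial_succ, Nat.cast_mul, Nat.cast_add, Nat.cast_one]
  rw [mul_div_assoc', mul_div_assoc', ← mul_div_mul_left _ (_ * Polynomial.eval _ _)
    (mul_ne_zero h1 hj)]
  congr 1 <;> ring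

lemma choose_recurrence (m k : ℕ) :
    ((k : ℂ) + 1) * ((-1) ^ (k + 1) * (m.choose (k + 1) : ℂ)) =
      (-m + k) * ((-1) ^ k * (m.choose k : ℂ)) := by
  have h : ((m.choose (k + 1) : ℂ)) * (k + 1) = m.choose k * (m - k) := by
    rcases le_or_gt k m with hk | hk
    · have := Nat.choose_succ_right_eq m k
      rw [← Nat.cast_sub hk]
      exact_mod_cast this
    · simp [Nat.choose_eq_zero_of_lt hk, Nat.choose_eq_zero_of_lt (Nat.lt_succ_of_lt hk)]
  rw [pow_succ]
  linear_combination (-(-1) ^ k) * h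

/-- Euler's transformation coefficientwise: for a = n/2, b = λ, c = λ-n/2+1 one has a+b-c = n-1 = m,
and the right side is the N-th coefficient of F(c-b, c-a; c; z). Both sides obey the same
first-order recurrence in N. -/
lemma sum_hypergeometricCoeff_pred (m : ℕ) (lam : ℂ) (N : ℕ)
    (hlam : ∀ j < N, lam - ((m + 1 : ℕ) : ℂ) / 2 + 1 + j ≠ 0) :
    ∑ j ∈ Finset.range (N + 1),
        hypergeometricCoeff (m + 1) lam j * ((-1) ^ (N - j) * (m.choose (N - j) : ℂ)) =
      (ascPochhammer ℂ N).eval (lam - ((m + 1 : ℕ) : ℂ) + 1) *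
        (ascPochhammer ℂ N).eval (1 - ((m + 1 : ℕ) : ℂ) / 2) /
        ((N.factorial : ℂ) * (ascPochhammer ℂ N).eval (lam - ((m + 1 : ℕ) : ℂ) / 2 + 1)) := by
  induction N with
  | zero => simp [hypergeometricCoeff]
  | succ N ih =>
    have ih := ih fun j hj => hlam j (by omega)
    have h := eulerTransform_recurrence (((m + 1 : ℕ) : ℂ) / 2) lam
      (lam - ((m + 1 : ℕ) : ℂ) / 2 + 1) (hypergeometricCoeff (m + 1) lam)
      (fun k => (-1) ^ k * (m.choose k : ℂ)) N
      (fun j hj => hypergeometricCoeff_succ _ _ _ (hlam j (by omega)))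
      (fun k _ => by
        rw [choose_recurrence]
        push_cast
        ring)
    have h1 : (N : ℂ) + 1 ≠ 0 := by exact_mod_cast Nat.succ_ne_zero N
    have h2 := hlam N (by omega)
    have h3 := ascPochhammer_eval_ne_zero hlam
    have h4 := ascPochhammer_eval_ne_zero fun j hj => hlam j (Nat.lt_succ_of_lt hj)
    have h5 : (N.factorial : ℂ) ≠ 0 := by exact_mod_cast N.factorial_ne_zero
    rw [ih] at h
    apply mul_left_cancel₀ (mul_ne_zero h1 h2)
    rw [h]
    simp only [ascPochhammer_succ_eval, Nat.factorial_succ, Nat.cast_mul]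
    rw [Nat.cast_add N 1, Nat.cast_one]
    generalize hc : lam - ((m + 1 : ℕ) : ℂ) / 2 + 1 = c at *
    obtain rfl : lam = c - 1 + ((m + 1 : ℕ) : ℂ) / 2 := by rw [← hc]; ring
    generalize ((m + 1 : ℕ) : ℂ) = ν at *
    field_simp
    ring

/-- The Taylor coefficients of `(1 - z)^n F(n/2, lam; lam - n/2 + 1; z)`. -/
lemma sum_hypergeometricCoeff (n : ℕ) (hn : 1 ≤ n) (lam : ℂ) (N : ℕ) (hN : 1 ≤ N)
    (hlam : ∀ j < N, lam - (n : ℂ) / 2 + 1 + j ≠ 0) :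
    ∑ j ∈ Finset.range (N + 1),
        hypergeometricCoeff n lam j * ((-1) ^ (N - j) * (n.choose (N - j) : ℂ)) =
      (-1 : ℂ) ^ N * ((ascPochhammer ℂ N).eval ((n : ℂ) / 2 - (N : ℂ) + 1) /
          (N.factorial : ℂ)) *
        (((lam - (n : ℂ) + 2 * (N : ℂ)) * (ascPochhammer ℂ (N - 1)).eval (lam - (n : ℂ) + 1)) /
          (ascPochhammer ℂ N).eval (lam - (n : ℂ) / 2 + 1)) := by
  obtain ⟨m, rfl⟩ : ∃ m, n = m + 1 := ⟨n - 1, by omega⟩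
  obtain ⟨M, rfl⟩ : ∃ M, N = M + 1 := ⟨N - 1, by omega⟩
  -- Pascal's rule, that is (1-z)^{m+1} = (1-z)(1-z)^m.
  have hsplit : ∑ j ∈ Finset.range (M + 1 + 1),
        hypergeometricCoeff (m + 1) lam j *
          ((-1) ^ (M + 1 - j) * ((m + 1).choose (M + 1 - j) : ℂ)) =
      ∑ j ∈ Finset.range (M + 1 + 1),
        hypergeometricCoeff (m + 1) lam j * ((-1) ^ (M + 1 - j) * (m.choose (M + 1 - j) : ℂ)) -
      ∑ j ∈ Finset.range (M + 1),
        hypergeometricCoeff (m + 1) lam j * ((-1) ^ (M - j) * (m.choose (M - j) : ℂ)) := by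
    rw [Finset.sum_range_succ, Finset.sum_range_succ _ (M + 1), add_sub_right_comm,
      ← Finset.sum_sub_distrib]
    congr 1
    · refine Finset.sum_congr rfl fun j hj => ?_
      rw [Finset.mem_range] at hj
      rw [Nat.succ_sub (by omega), Nat.succ_eq_add_one, Nat.choose_succ_succ, pow_succ]
      push_cast
      ring
    · simp
  -- Reversing the order and the signs of the factors: (-1)^N (x-N+1)_N = (-x)_N = -x (1-x)_{N-1}
  -- with x = n/2.
  have hneg : (-1 : ℂ) ^ (M + 1) *
      (ascPochhammer ℂ (M + 1)).eval (((m + 1 : ℕ) : ℂ) / 2 - ((M + 1 : ℕ) : ℂ) + 1) =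
      -(((m + 1 : ℕ) : ℂ) / 2) * (ascPochhammer ℂ M).eval (1 - ((m + 1 : ℕ) : ℂ) / 2) := by
    rw [← descPochhammer_eval_eq_ascPochhammer, ← ascPochhammer_eval_neg_eq_descPochhammer,
      ascPochhammer_eval_succ_left]
    ring_nf
  rw [hsplit, sum_hypergeometricCoeff_pred m lam (M + 1) hlam,
    sum_hypergeometricCoeff_pred m lam M fun j hj => hlam j (by omega),
    ← mul_div_assoc ((-1 : ℂ) ^ (M + 1)), hneg]
  have h1 : (M : ℂ) + 1 ≠ 0 := by exact_mod_cast Nat.succ_ne_zero M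
  have h2 := hlam M (by omega)
  have h4 := ascPochhammer_eval_ne_zero fun j hj => hlam j (Nat.lt_succ_of_lt hj)
  have h5 : (M.factorial : ℂ) ≠ 0 := by exact_mod_cast M.factorial_ne_zero
  simp only [ascPochhammer_succ_eval, Nat.factorial_succ, Nat.cast_mul, Nat.add_sub_cancel]
  rw [Nat.cast_add M 1, Nat.cast_one]
  clear hneg hsplit hlam
  generalize hc : lam - ((m + 1 : ℕ) : ℂ) / 2 + 1 = c at *
  obtain rfl : lam = c - 1 + ((m + 1 : ℕ) : ℂ) / 2 := by rw [← hc]; ring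
  generalize ((m + 1 : ℕ) : ℂ) = ν at *
  field_simp
  ring

/-! ### Polynomials vanishing to high order at the origin -/

/-- The bridge from asymptotics to algebra: it turns the O-conditions on v and on u into vanishing
of finitely many coefficients. -/
lemma X_pow_dvd_iff_isBigO (p : Polynomial ℂ) (m : ℕ) :
    Polynomial.X ^ m ∣ p ↔
      (fun r : ℝ => p.eval (r : ℂ)) =O[𝓝[>] (0 : ℝ)] fun r : ℝ => r ^ m := by
  have hcont : ∀ q : Polynomial ℂ, Continuous fun r : ℝ => q.eval (r : ℂ) := fun q =>
    q.continuous.comp Complex.continuous_ofReal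
  have hbd : ∀ q : Polynomial ℂ,
      (fun r : ℝ => q.eval (r : ℂ)) =O[𝓝[>] (0 : ℝ)] fun _ : ℝ => (1 : ℝ) := fun q =>
    ((hcont q).continuousAt.tendsto.mono_left nhdsWithin_le_nhds).isBigO_one ℝ
  constructor
  · rintro ⟨q, rfl⟩
    have h : (fun r : ℝ => ((r : ℂ)) ^ m) =O[𝓝[>] (0 : ℝ)] fun r : ℝ => r ^ m :=
      Asymptotics.isBigO_of_le _ fun r => by simp
    simpa using h.mul (hbd q)
  · induction m with
    | zero => simp
    | succ m ih =>
      intro h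
      have h0 : (fun r : ℝ => r ^ (m + 1)) =O[𝓝[>] (0 : ℝ)] fun r : ℝ => r ^ m := by
        have h1 : (fun r : ℝ => r) =O[𝓝[>] (0 : ℝ)] fun _ : ℝ => (1 : ℝ) :=
          (continuous_id.continuousAt.tendsto.mono_left nhdsWithin_le_nhds).isBigO_one ℝ
        simpa [pow_succ] using (Asymptotics.isBigO_refl (fun r : ℝ => r ^ m) _).mul h1
      obtain ⟨q, rfl⟩ := ih (h.trans h0)
      -- Dividing by r^m > 0 leaves q = O(r), so q(0) = 0 and one more factor X splits off.
      have hq : (fun r : ℝ => q.eval (r : ℂ)) =O[𝓝[>] (0 : ℝ)] fun r : ℝ => r := by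
        rw [Asymptotics.isBigO_iff] at h ⊢
        obtain ⟨c, hc⟩ := h
        refine ⟨c, ?_⟩
        filter_upwards [hc, self_mem_nhdsWithin] with r hr hr0
        have hr0 : 0 < r := hr0
        have hm : 0 < r ^ m := pow_pos hr0 m
        simp only [Polynomial.eval_mul, Polynomial.eval_pow, Polynomial.eval_X, norm_mul, norm_pow,
          Complex.norm_real, Real.norm_eq_abs, abs_of_pos hr0, pow_succ] at hr ⊢
        refine le_of_mul_le_mul_left ?_ hm
        linarith
      have hlim : Filter.Tendsto (fun r : ℝ => q.eval (r : ℂ)) (𝓝[>] (0 : ℝ)) (𝓝 0) :=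
        hq.trans_tendsto (continuous_id.continuousAt.tendsto.mono_left nhdsWithin_le_nhds)
      have hq0 : q.eval ((0 : ℝ) : ℂ) = 0 :=
        tendsto_nhds_unique ((hcont q).continuousAt.tendsto.mono_left nhdsWithin_le_nhds) hlim
      rw [pow_succ]
      refine mul_dvd_mul_left _ (Polynomial.X_dvd_iff.2 ?_)
      rw [Polynomial.coeff_zero_eq_eval_zero]
      simpa using hq0

variable {n : ℕ}

/-! ### The Ricci tensor of the Poincaré metric -/

lemma pd_congr {F : Type} [NormedAddCommGroup F] [NormedSpace ℝ F] {u v : Ambient n → F}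
    {y : Ambient n} (h : u =ᶠ[𝓝 y] v) (a : Fin (n + 1)) : pd a u y = pd a v y := by
  rw [pd, pd, h.fderiv_eq]

lemma pd_const {F : Type} [NormedAddCommGroup F] [NormedSpace ℝ F] (c : F) (y : Ambient n)
    (a : Fin (n + 1)) : pd a (fun _ => c) y = 0 := by
  simp [pd]

lemma pd_comp_normSq {f : ℝ → ℝ} {f' : ℝ} {y : Ambient n} (hf : HasDerivAt f f' (‖y‖ ^ 2))
    (a : Fin (n + 1)) : pd a (fun z : Ambient n => f (‖z‖ ^ 2)) y = f' * (2 * y a) := by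
  have h := hf.comp_hasFDerivAt y (hasStrictFDerivAt_norm_sq y).hasFDerivAt
  have h2 : fderiv ℝ (fun z : Ambient n => f (‖z‖ ^ 2)) y = _ := h.fderiv
  rw [pd, h2]
  simp [two_mul, EuclideanSpace.inner_single_right]

lemma eventually_norm_lt_one {y : Ambient n} (hy : ‖y‖ < 1) : ∀ᶠ z in 𝓝 y, ‖z‖ < 1 :=
  continuous_norm.continuousAt.eventually_lt continuousAt_const hy

lemma one_sub_normSq_pos {y : Ambient n} (hy : ‖y‖ < 1) : 0 < 1 - ‖y‖ ^ 2 := by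
  nlinarith [norm_nonneg y]

lemma hasDerivAt_inv_one_sub {s : ℝ} (hs : 1 - s ≠ 0) :
    HasDerivAt (fun s : ℝ => (1 - s)⁻¹) ((1 - s) ^ 2)⁻¹ s := by
  have := ((hasDerivAt_id' s).const_sub 1).fun_inv hs
  simpa [neg_div, div_eq_mul_inv] using this

lemma pd_poincareMetric {y : Ambient n} (hy : ‖y‖ < 1) (a b c : Fin (n + 1)) :
    pd a (fun z => poincareMetric n z b c) y =
      16 * y a / (1 - ‖y‖ ^ 2) ^ 3 * if b = c then 1 else 0 := by
  have h0 := (one_sub_normSq_pos hy).ne'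
  by_cases hbc : b = c
  · subst hbc
    have h : (fun z : Ambient n => poincareMetric n z b b) =
        fun z => (fun s : ℝ => 4 * ((1 - s)⁻¹) ^ 2) (‖z‖ ^ 2) := by
      funext z
      simp [poincareMetric, div_eq_mul_inv]
    rw [h, pd_comp_normSq (((hasDerivAt_inv_one_sub h0).fun_pow 2).const_mul 4)]
    simp
    field_simp
    ring
  · have h : (fun z : Ambient n => poincareMetric n z b c) = fun _ => 0 := by
      funext z
      simp [poincareMetric, hbc]
    rw [h, pd_const]
    simp [hbc]

lemma poincareMetric_inv {y : Ambient n} (hy : ‖y‖ < 1) :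
    (poincareMetric n y)⁻¹ = ((1 - ‖y‖ ^ 2) ^ 2 / 4 : ℝ) • (1 : Matrix _ _ ℝ) := by
  have h0 := (one_sub_normSq_pos hy).ne'
  apply Matrix.inv_eq_right_inv
  rw [poincareMetric, smul_mul_smul_comm, mul_one]
  have : (4 / (1 - ‖y‖ ^ 2) ^ 2 : ℝ) * ((1 - ‖y‖ ^ 2) ^ 2 / 4) = 1 := by field_simp
  rw [this, one_smul]

/-- The gradient `2 y_a / (1 - |y|²)` of the logarithm of the conformal factor `2 / (1 - |y|²)`. -/
def conformalGradient (a : Fin (n + 1)) (y : Ambient n) : ℝ := 2 * y a * (1 - ‖y‖ ^ 2)⁻¹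

/-- The formula for a conformally flat metric e^{2ω}δ, with ω_a = ∂_a ω given by
`conformalGradient`. -/
lemma christoffel_poincareMetric {y : Ambient n} (hy : ‖y‖ < 1) (c a b : Fin (n + 1)) :
    christoffel (poincareMetric n) c a b y =
      conformalGradient a y * (if b = c then 1 else 0) +
        conformalGradient b y * (if a = c then 1 else 0) -
        conformalGradient c y * (if a = b then 1 else 0) := by
  have h0 := (one_sub_normSq_pos hy).ne'
  unfold christoffel
  rw [poincareMetric_inv hy]
  simp only [pd_poincareMetric hy, Matrix.smul_apply, Matrix.one_apply, smul_eq_mul]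
  rw [Finset.sum_eq_single c (fun d _ hd => by simp [hd.symm]) (by simp)]
  simp only [conformalGradient, if_true]
  field_simp
  ring

lemma differentiableAt_conformalGradient {y : Ambient n} (hy : ‖y‖ < 1) (a : Fin (n + 1)) :
    DifferentiableAt ℝ (conformalGradient a : Ambient n → ℝ) y := by
  have h0 := (one_sub_normSq_pos hy).ne'
  unfold conformalGradient
  have h1 : DifferentiableAt ℝ (fun z : Ambient n => z a) y :=
    (EuclideanSpace.proj a : Ambient n →L[ℝ] ℝ).differentiableAt
  have h2 : DifferentiableAt ℝ (fun z : Ambient n => ‖z‖ ^ 2) y :=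
    (hasStrictFDerivAt_norm_sq y).hasFDerivAt.differentiableAt
  exact (h1.const_mul 2).mul ((h2.const_sub 1).inv h0)

/-- The Hessian of ω is algebraic in ∇ω and 1 - |y|², so the Ricci tensor involves no further
derivatives. -/
lemma pd_conformalGradient {y : Ambient n} (hy : ‖y‖ < 1) (a b : Fin (n + 1)) :
    pd b (conformalGradient a) y = 2 * (1 - ‖y‖ ^ 2)⁻¹ * (if a = b then 1 else 0) +
      conformalGradient a y * conformalGradient b y := by
  have h0 := (one_sub_normSq_pos hy).ne'
  have h1 : HasFDerivAt (fun z : Ambient n => 2 * z a)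
      ((2 : ℝ) • (EuclideanSpace.proj a : Ambient n →L[ℝ] ℝ)) y :=
    (EuclideanSpace.proj a : Ambient n →L[ℝ] ℝ).hasFDerivAt.const_mul 2
  have h2 := (hasDerivAt_inv_one_sub h0).comp_hasFDerivAt y
    (hasStrictFDerivAt_norm_sq y).hasFDerivAt
  have h3 : fderiv ℝ (conformalGradient a : Ambient n → ℝ) y = _ := (h1.mul h2).fderiv
  rw [pd, h3]
  simp [conformalGradient, EuclideanSpace.inner_single_right]
  by_cases hab : a = b
  · simp [hab]
    field_simp
    ring
  · simp [hab]
    field_simp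

/-- The Poincaré metric is an Einstein metric. -/
theorem ricci_poincareMetric {y : Ambient n} (hy : ‖y‖ < 1) (a b : Fin (n + 1)) :
    ricci (poincareMetric n) a b y + (n : ℝ) * poincareMetric n y a b = 0 := by
  have h0 := (one_sub_normSq_pos hy).ne'
  have hev := eventually_norm_lt_one hy
  have hd := fun e => differentiableAt_conformalGradient hy e
  have hpd : ∀ e c a b : Fin (n + 1), pd e (christoffel (poincareMetric n) c a b) y =
      pd e (conformalGradient a) y * (if b = c then 1 else 0) +
        pd e (conformalGradient b) y * (if a = c then 1 else 0) -
        pd e (conformalGradient c) y * (if a = b then 1 else 0) := by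
    intro e c a b
    rw [pd_congr (hev.mono fun z hz => christoffel_poincareMetric hz c a b)]
    simp only [pd]
    rw [fderiv_fun_sub (((hd a).mul_const _).fun_add ((hd b).mul_const _)) ((hd c).mul_const _),
      fderiv_fun_add ((hd a).mul_const _) ((hd b).mul_const _), fderiv_mul_const (hd a),
      fderiv_mul_const (hd b), fderiv_mul_const (hd c)]
    split_ifs <;> simp
  have hS : ∑ c, conformalGradient c y * conformalGradient c y =
      4 * ‖y‖ ^ 2 * ((1 - ‖y‖ ^ 2)⁻¹) ^ 2 := by
    rw [EuclideanSpace.real_norm_sq_eq, Finset.mul_sum, Finset.sum_mul]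
    refine Finset.sum_congr rfl fun c _ => ?_
    simp only [conformalGradient, EuclideanSpace.real_norm_sq_eq]
    ring
  unfold ricci
  simp only [hpd, pd_conformalGradient hy, christoffel_poincareMetric hy]
  -- What remains is a contraction of Kronecker deltas with a vector P; only its squared length `hS`
  -- is needed.
  generalize hP : (fun c => conformalGradient c y) = P at *
  have hP' : ∀ c, conformalGradient c y = P c := fun c => congrFun hP c
  simp only [hP'] at hS ⊢
  have hn : ((Finset.univ : Finset (Fin (n + 1))).card : ℝ) = n + 1 := by simp
  simp only [Finset.sum_sub_distrib, Finset.sum_add_distrib, mul_add, add_mul, mul_sub, sub_mul,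
    mul_ite, ite_mul, mul_one, mul_zero, zero_mul, Finset.sum_ite_eq, Finset.sum_ite_eq',
    Finset.mem_univ, if_true, Finset.sum_const, nsmul_eq_mul, hn]
  have hdouble : ∀ g : Fin (n + 1) → Fin (n + 1) → ℝ,
      ∑ x, ∑ z, (if a = x then g x z else 0) = ∑ z, g a z := by
    intro g
    rw [Finset.sum_eq_single a (fun x _ hx => by simp [hx.symm]) (by simp)]
    simp
  rw [hdouble]
  by_cases hab : a = b
  · subst hab
    simp only [if_true, Finset.sum_add_distrib, Finset.sum_sub_distrib, Finset.sum_ite_eq,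
      Finset.sum_ite_eq', Finset.mem_univ, Finset.sum_const, nsmul_eq_mul, hn, hS, poincareMetric,
      Matrix.smul_apply, Matrix.one_apply_eq, smul_eq_mul]
    field_simp
    ring
  · have hba : ¬ b = a := fun h => hab h.symm
    simp only [hab, hba, if_false, Finset.sum_add_distrib, Finset.sum_sub_distrib,
      Finset.sum_ite_eq, Finset.sum_ite_eq', Finset.mem_univ, if_true, Finset.sum_const_zero,
      poincareMetric, Matrix.smul_apply, Matrix.one_apply_ne hab, smul_eq_mul]
    ring

/-! ### The collar and the slice metrics -/

lemma norm_sphere (θ : Sph n) : ‖(θ : Ambient n)‖ = 1 := by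
  simp

lemma poincareMetric_apply (y a b : Ambient n) :
    (poincareMetric n).apply y a b = 4 / (1 - ‖y‖ ^ 2) ^ 2 * inner ℝ a b := by
  unfold MetricField.apply poincareMetric
  rw [PiLp.inner_apply, Finset.mul_sum]
  refine Finset.sum_congr rfl fun i _ => ?_
  rw [Finset.sum_eq_single i (fun j _ hj => by simp [Matrix.one_apply_ne hj.symm]) (by simp)]
  simp
  ring

lemma norm_collar_sq (r : ℝ) (θ : Sph n) :
    ‖collar n (r, (θ : Ambient n))‖ ^ 2 = ((2 - r) / (2 + r)) ^ 2 := by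
  simp only [collar, norm_smul, norm_sphere, mul_one, Real.norm_eq_abs, sq_abs]

lemma fderiv_collar {r : ℝ} (hr : 2 + r ≠ 0) (θ a : Ambient n) (s : ℝ) :
    fderiv ℝ (collar n) (r, θ) (s, a) =
      ((2 - r) / (2 + r)) • a + (-4 / (2 + r) ^ 2 * s) • θ := by
  have h1 : HasDerivAt (fun r : ℝ => (2 - r) / (2 + r)) (-4 / (2 + r) ^ 2) r := by
    refine (((hasDerivAt_id' r).const_sub 2).fun_div
      ((hasDerivAt_id' r).const_add 2) hr).congr_deriv ?_
    ring
  have h2 := HasDerivAt.comp_hasFDerivAt (x := ((r, θ) : ℝ × Ambient n)) (f := Prod.fst) h1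
    (hasFDerivAt_fst (𝕜 := ℝ))
  have h3 := h2.smul (hasFDerivAt_snd (𝕜 := ℝ) (p := (r, θ)))
  have h4 : fderiv ℝ (collar n) (r, θ) = _ := h3.fderiv
  rw [h4]
  simp

/-- For fixed r the collar map is the linear scaling by q = (2-r)/(2+r), and 1 - q² = 8r/(2+r)²
cancels the factor r². -/
lemma sliceMetric_eq {r : ℝ} (hr : r ∈ Set.Ioo (0 : ℝ) 2) (θ : Sph n) (a b : Ambient n) :
    sliceMetric n r (θ : Ambient n) a b = (1 - r ^ 2 / 4) ^ 2 * inner ℝ a b := by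
  have h0 : r ≠ 0 := hr.1.ne'
  have h2 : 2 + r ≠ 0 := by linarith [hr.1]
  have hf : ∀ v : Ambient n, fderiv ℝ (fun z => collar n (r, z)) (θ : Ambient n) v =
      ((2 - r) / (2 + r)) • v := by
    intro v
    have h : HasFDerivAt (fun z : Ambient n => collar n (r, z))
        (((2 - r) / (2 + r)) • ContinuousLinearMap.id ℝ (Ambient n)) (θ : Ambient n) :=
      (hasFDerivAt_id (𝕜 := ℝ) (θ : Ambient n)).const_smul ((2 - r) / (2 + r))
    rw [h.fderiv]
    simp
  unfold sliceMetric
  rw [poincareMetric_apply, norm_collar_sq, hf, hf, real_inner_smul_left, real_inner_smul_right]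
  have h1 : 1 - ((2 - r) / (2 + r)) ^ 2 = 8 * r / (2 + r) ^ 2 := by
    field_simp
    ring
  rw [h1]
  field_simp
  ring

/-- The Poincaré metric is in normal form on the collar. -/
theorem poincareMetric_collar {r : ℝ} (hr : r ∈ Set.Ioo (0 : ℝ) 2) (θ : Sph n) (s t : ℝ)
    (a b : Ambient n) (ha : inner ℝ (θ : Ambient n) a = 0) (hb : inner ℝ (θ : Ambient n) b = 0) :
    (poincareMetric n).apply (collar n (r, (θ : Ambient n)))
        (fderiv ℝ (collar n) (r, (θ : Ambient n)) (s, a))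
        (fderiv ℝ (collar n) (r, (θ : Ambient n)) (t, b)) =
      (r ^ 2)⁻¹ * (s * t + sliceMetric n r (θ : Ambient n) a b) := by
  have h0 : r ≠ 0 := hr.1.ne'
  have h2 : 2 + r ≠ 0 := by linarith [hr.1]
  have ha' : inner ℝ a (θ : Ambient n) = 0 := by rw [real_inner_comm, ha]
  rw [sliceMetric_eq hr, poincareMetric_apply, norm_collar_sq, fderiv_collar h2, fderiv_collar h2]
  simp only [inner_add_left, inner_add_right, real_inner_smul_left, real_inner_smul_right, ha',
    hb, real_inner_self_eq_norm_sq, norm_sphere]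
  have h1 : 1 - ((2 - r) / (2 + r)) ^ 2 = 8 * r / (2 + r) ^ 2 := by
    field_simp
    ring
  rw [h1]
  field_simp
  ring

/-- The Gram matrix is (1-r²/4)² times the identity of size dim θ^⊥ = n; for r < 2 the base is
nonnegative, so the square root is the plain power. -/
lemma volumeRatio_eq {r : ℝ} (hr : r ∈ Set.Ioo (0 : ℝ) 2) (θ : Sph n) :
    volumeRatio n r θ = (1 - r ^ 2 / 4) ^ n := by
  have hpos : 0 ≤ 1 - r ^ 2 / 4 := by nlinarith [hr.1, hr.2]
  have hrank : Module.finrank ℝ ↥(Submodule.span ℝ {(θ : Ambient n)})ᗮ = n := by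
    apply Submodule.finrank_orthogonal_span_singleton
    rw [← norm_ne_zero_iff, norm_sphere]
    exact one_ne_zero
  unfold volumeRatio
  simp only [sliceMetric_eq hr]
  have hM : (Matrix.of fun i j =>
      (1 - r ^ 2 / 4) ^ 2 *
        inner ℝ ((stdOrthonormalBasis ℝ ↥(Submodule.span ℝ {(θ : Ambient n)})ᗮ i : Ambient n))
          (stdOrthonormalBasis ℝ ↥(Submodule.span ℝ {(θ : Ambient n)})ᗮ j : Ambient n)) =
      (1 - r ^ 2 / 4) ^ 2 • (1 : Matrix _ _ ℝ) := by
    ext i j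
    have h := orthonormal_iff_ite.1
      (stdOrthonormalBasis ℝ ↥(Submodule.span ℝ {(θ : Ambient n)})ᗮ).orthonormal i j
    rw [Submodule.coe_inner] at h
    simp [h, Matrix.one_apply]
  rw [hM, Matrix.det_smul, Matrix.det_one, Fintype.card_fin, hrank, mul_one, ← pow_mul,
    mul_comm 2 n, pow_mul, Real.sqrt_sq (pow_nonneg hpos n)]

/-! ### Holographic coefficients as binomial coefficients -/

/-- Constant functions on the sphere. -/
def constFun (n : ℕ) (c : ℂ) : SmoothFun n := ⟨fun _ => c, contMDiff_const⟩

@[simp] lemma constFun_apply (c : ℂ) (θ : Sph n) : constFun n c θ = c := rfl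

/-- The binomial expansion of `(1 - x²/4)^n`. -/
lemma one_sub_sq_pow (n : ℕ) (x : ℂ) :
    (1 - x ^ 2 / 4) ^ n = ∑ j ∈ Finset.range (n + 1),
      ((n.choose j : ℂ) * (-1 / 4) ^ j) * x ^ (2 * j) := by
  have h := add_pow (-(x ^ 2) / 4) 1 n
  rw [show 1 - x ^ 2 / 4 = -(x ^ 2) / 4 + 1 by ring, h]
  refine Finset.sum_congr rfl fun j _ => ?_
  rw [one_pow, pow_mul, show -(x ^ 2) / 4 = (-1 / 4) * x ^ 2 by ring, mul_pow]
  ring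

open Polynomial in
/-- The even polynomial with coefficients `c j` at `X ^ (2 * j)`. -/
def evenPoly (N : ℕ) (c : ℕ → ℂ) : Polynomial ℂ :=
  ∑ j ∈ Finset.range N, C (c j) * X ^ (2 * j)

lemma evenPoly_eval (N : ℕ) (c : ℕ → ℂ) (x : ℂ) :
    (evenPoly N c).eval x = ∑ j ∈ Finset.range N, c j * x ^ (2 * j) := by
  simp [evenPoly, Polynomial.eval_finsetSum]

lemma evenPoly_coeff (N : ℕ) (c : ℕ → ℂ) (k : ℕ) :
    (evenPoly N c).coeff (2 * k) = if k < N then c k else 0 := by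
  simp [evenPoly, Polynomial.coeff_X_pow]

lemma evenPoly_coeff_odd (N : ℕ) (c : ℕ → ℂ) (k : ℕ) :
    (evenPoly N c).coeff (2 * k + 1) = 0 := by
  simp only [evenPoly, Polynomial.finsetSum_coeff, Polynomial.coeff_C_mul, Polynomial.coeff_X_pow]
  refine Finset.sum_eq_zero fun j _ => ?_
  rw [if_neg (by omega), mul_zero]

lemma isHolographicCoefficients_iff (N : ℕ) (v : ℕ → SmoothFun n) :
    IsHolographicCoefficients n N v ↔
      ∀ j ≤ N, ∀ θ, v j θ = (n.choose j : ℂ) * (-1 / 4) ^ j := by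
  have key : ∀ θ : Sph n, ((fun r : ℝ => ((volumeRatio n r θ : ℝ) : ℂ) -
      ∑ j ∈ Finset.range (N + 1), v j θ * ((r ^ (2 * j) : ℝ) : ℂ))
      =O[𝓝[>] (0 : ℝ)] fun r : ℝ => r ^ (2 * N + 1)) ↔
      ∀ j ≤ N, v j θ = (n.choose j : ℂ) * (-1 / 4) ^ j := by
    intro θ
    set p : Polynomial ℂ := evenPoly (n + 1) (fun j => (n.choose j : ℂ) * (-1 / 4) ^ j) -
      evenPoly (N + 1) (fun j => v j θ) with hp
    have hev : (fun r : ℝ => ((volumeRatio n r θ : ℝ) : ℂ) -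
        ∑ j ∈ Finset.range (N + 1), v j θ * ((r ^ (2 * j) : ℝ) : ℂ)) =ᶠ[𝓝[>] (0 : ℝ)]
        fun r : ℝ => p.eval (r : ℂ) := by
      filter_upwards [Ioo_mem_nhdsGT (show (0 : ℝ) < 2 by norm_num)] with r hr
      rw [volumeRatio_eq hr, hp, Polynomial.eval_sub, evenPoly_eval, evenPoly_eval,
        ← one_sub_sq_pow]
      push_cast
      rfl
    rw [Asymptotics.isBigO_congr hev Filter.EventuallyEq.rfl, ← X_pow_dvd_iff_isBigO,
      Polynomial.X_pow_dvd_iff]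
    -- N may exceed n; the binomial coefficients beyond n vanish, so the cut-off in the expansion
    -- can be dropped.
    have hchoose : ∀ j, (if j < n + 1 then (n.choose j : ℂ) * (-1 / 4) ^ j else 0) =
        (n.choose j : ℂ) * (-1 / 4) ^ j := by
      intro j
      split_ifs with h
      · rfl
      · rw [Nat.choose_eq_zero_of_lt (by omega)]
        simp
    constructor
    · intro h j hj
      have := h (2 * j) (by omega)
      rw [hp, Polynomial.coeff_sub, evenPoly_coeff, evenPoly_coeff, hchoose,
        if_pos (by omega)] at this
      exact (sub_eq_zero.1 this).symm
    · intro h d hd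
      rcases Nat.even_or_odd' d with ⟨k, rfl | rfl⟩
      · rw [hp, Polynomial.coeff_sub, evenPoly_coeff, evenPoly_coeff, hchoose,
          if_pos (by omega), h k (by omega), sub_self]
      · rw [hp, Polynomial.coeff_sub, evenPoly_coeff_odd, evenPoly_coeff_odd, sub_self]
  unfold IsHolographicCoefficients
  simp only [key]
  exact ⟨fun h j hj θ => h θ j hj, fun h θ j hj => h j hj θ⟩

/-! ### Radial extensions and the Laplacian of the sphere -/

lemma radialExtension_of_ne (f : Sph n → ℂ) {y : Ambient n} (hy : y ≠ 0) (θ : Sph n)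
    (h : (θ : Ambient n) = ‖y‖⁻¹ • y) : radialExtension f y = f θ := by
  unfold radialExtension
  rw [dif_pos hy]
  congr 1
  exact Subtype.ext h.symm

lemma radialExtension_zero (f : Sph n → ℂ) : radialExtension f 0 = 0 := by
  simp [radialExtension]

lemma sphere_ne_zero (θ : Sph n) : (θ : Ambient n) ≠ 0 := by
  rw [← norm_ne_zero_iff, norm_sphere]
  exact one_ne_zero

/-- The projection of a nonzero vector to the sphere. -/
def toSph {y : Ambient n} (hy : y ≠ 0) : Sph n :=
  ⟨‖y‖⁻¹ • y, by simp [norm_smul, inv_mul_cancel₀ (norm_ne_zero_iff.mpr hy)]⟩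

lemma radialExtension_eq_toSph (f : Sph n → ℂ) {y : Ambient n} (hy : y ≠ 0) :
    radialExtension f y = f (toSph hy) := radialExtension_of_ne f hy _ rfl

lemma radialExtension_sphere (f : Sph n → ℂ) (θ : Sph n) :
    radialExtension f (θ : Ambient n) = f θ :=
  radialExtension_of_ne f (sphere_ne_zero θ) θ (by simp)

lemma radialExtension_smul (f : Sph n → ℂ) {t : ℝ} (ht : 0 < t) (y : Ambient n) :
    radialExtension f (t • y) = radialExtension f y := by
  by_cases hy : y = 0
  · simp [hy]
  · rw [radialExtension_eq_toSph f hy]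
    refine radialExtension_of_ne f (smul_ne_zero ht.ne' hy) _ ?_
    rw [norm_smul, Real.norm_of_nonneg ht.le, mul_inv, smul_smul, mul_right_comm,
      inv_mul_cancel₀ ht.ne', one_mul]
    rfl

lemma eventually_ne_zero {y : Ambient n} (hy : y ≠ 0) : ∀ᶠ z in 𝓝 y, z ≠ 0 :=
  isOpen_ne.mem_nhds hy

/-- Away from 0 the extension is f composed with z ↦ z/|z|, a smooth map from the open submanifold
of nonzero vectors to the sphere. -/
lemma contDiffAt_radialExtension (f : SmoothFun n) {y : Ambient n} (hy : y ≠ 0) :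
    ContDiffAt ℝ ∞ (radialExtension f) y := by
  let U : TopologicalSpace.Opens (Ambient n) := ⟨{z | z ≠ 0}, isOpen_ne⟩
  have hU : ∀ z : U, (z : Ambient n) ≠ 0 := fun z => z.2
  have hmem : ∀ z : U, ‖(z : Ambient n)‖⁻¹ • (z : Ambient n) ∈ Metric.sphere (0 : Ambient n) 1 :=
    fun z => by simp [norm_smul, inv_mul_cancel₀ (norm_ne_zero_iff.mpr (hU z))]
  have h1 : ContMDiff 𝓘(ℝ, Ambient n) 𝓘(ℝ, Ambient n) ∞
      (fun z : U => ‖(z : Ambient n)‖⁻¹ • (z : Ambient n)) := by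
    intro z
    refine (contMDiffAt_subtype_iff (f := fun z : Ambient n => ‖z‖⁻¹ • z)).2
      (ContDiffAt.contMDiffAt ?_)
    exact ((contDiffAt_norm ℝ (hU z)).inv (norm_ne_zero_iff.2 (hU z))).smul contDiffAt_id
  have h2 := f.contMDiff.comp (h1.codRestrict_sphere (n := n) hmem)
  have h3 := h2 ⟨y, hy⟩
  refine ContMDiffAt.contDiffAt ((contMDiffAt_subtype_iff (U := U) (x := ⟨y, hy⟩)).1 ?_)
  refine h3.congr_of_eventuallyEq (Filter.Eventually.of_forall fun z => ?_)
  exact radialExtension_of_ne f (hU z) _ rfl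

lemma contDiffAt_pd {u : Ambient n → ℂ} {y : Ambient n} (hu : ContDiffAt ℝ ∞ u y)
    (a : Fin (n + 1)) : ContDiffAt ℝ ∞ (pd a u) y :=
  (hu.fderiv_right (m := ∞) (by simp)).clm_apply contDiffAt_const

lemma differentiableAt_of_contDiffAt_infty {u : Ambient n → ℂ} {y : Ambient n}
    (hu : ContDiffAt ℝ ∞ u y) : DifferentiableAt ℝ u y :=
  hu.differentiableAt (by simp)

lemma fderiv_eq_sum_pd (u : Ambient n → ℂ) (y v : Ambient n) :
    fderiv ℝ u y v = ∑ a, (v a : ℂ) * pd a u y := by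
  have hv : v = ∑ a, v a • EuclideanSpace.single a (1 : ℝ) := by
    ext i
    simp [Finset.sum_apply, Pi.single_apply]
  conv_lhs => rw [hv]
  rw [map_sum]
  refine Finset.sum_congr rfl fun a _ => ?_
  rw [map_smul, Complex.real_smul]
  rfl

/-- Euler's identity in degree 0, from differentiating t ↦ F(ty) at t = 1. It kills every cross term
between a radial gradient and ∇F below. -/
lemma sum_mul_pd_radialExtension (f : SmoothFun n) {y : Ambient n} (hy : y ≠ 0) :
    ∑ a, (y a : ℂ) * pd a (radialExtension f) y = 0 := by
  rw [← fderiv_eq_sum_pd]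
  have hd : HasFDerivAt (radialExtension f) (fderiv ℝ (radialExtension f) y) ((1 : ℝ) • y) := by
    rw [one_smul]
    exact (differentiableAt_of_contDiffAt_infty (contDiffAt_radialExtension f hy)).hasFDerivAt
  have h1 : HasDerivAt (fun t : ℝ => t • y) ((1 : ℝ) • y) 1 := (hasDerivAt_id' (1 : ℝ)).smul_const y
  have h2 := hd.comp_hasDerivAt (1 : ℝ) h1
  have h3 : (radialExtension f ∘ fun t : ℝ => t • y) =ᶠ[𝓝 1] fun _ => radialExtension f y := by
    filter_upwards [Ioi_mem_nhds (zero_lt_one' ℝ)] with t ht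
    exact radialExtension_smul f ht y
  have h4 := h2.unique ((hasDerivAt_const (1 : ℝ) (radialExtension f y)).congr_of_eventuallyEq h3)
  simpa using h4

lemma pd_const_mul (c : ℂ) (u : Ambient n → ℂ) (y : Ambient n) (a : Fin (n + 1)) :
    pd a (fun z => c * u z) y = c * pd a u y := by
  have h : fderiv ℝ (fun z => c * u z) y = c • fderiv ℝ u y :=
    congrFun (fderiv_const_smul_field c) y
  rw [pd, h]
  rfl

/-- The Laplacian of `ℝ^{n+1}`. -/
def euclideanLaplacian (u : Ambient n → ℂ) (y : Ambient n) : ℂ := ∑ a, pd a (pd a u) y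

lemma pd_comp_smul (u : Ambient n → ℂ) (t : ℝ) (a : Fin (n + 1)) (y : Ambient n) :
    pd a (fun z => u (t • z)) y = t * pd a u (t • y) := by
  unfold pd
  rw [fderiv_comp_smul]
  simp

/-- Two derivatives lower the degree of homogeneity from 0 to -2. -/
lemma euclideanLaplacian_radialExtension_smul (f : SmoothFun n) {t : ℝ} (ht : 0 < t)
    (y : Ambient n) :
    (t : ℂ) ^ 2 * euclideanLaplacian (radialExtension f) (t • y) =
      euclideanLaplacian (radialExtension f) y := by
  unfold euclideanLaplacian
  rw [Finset.mul_sum]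
  refine Finset.sum_congr rfl fun a _ => ?_
  have ht' : (t : ℂ) ≠ 0 := by exact_mod_cast ht.ne'
  have h1 : ∀ z, pd a (radialExtension f) z = t * pd a (radialExtension f) (t • z) := by
    intro z
    rw [← pd_comp_smul]
    simp only [radialExtension_smul f ht]
  have h2 : pd a (radialExtension f) =
      fun z => t * (fun z => pd a (radialExtension f) (t • z)) z := funext h1
  have h3 : pd a (fun z => (t : ℂ) * pd a (radialExtension f) (t • z)) y =
      t * pd a (fun z => pd a (radialExtension f) (t • z)) y := by
    exact pd_const_mul _ _ _ _
  conv_rhs => rw [h2]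
  rw [h3, pd_comp_smul]
  ring

lemma contDiffAt_euclideanLaplacian {u : Ambient n → ℂ} {y : Ambient n}
    (hu : ContDiffAt ℝ ∞ u y) : ContDiffAt ℝ ∞ (euclideanLaplacian u) y := by
  unfold euclideanLaplacian
  exact ContDiffAt.sum fun a _ => contDiffAt_pd (contDiffAt_pd hu a) a

/-- The restriction to the sphere of a function which is smooth near the sphere. -/
def restrictSphere (u : Ambient n → ℂ) (hu : ∀ y : Ambient n, y ≠ 0 → ContDiffAt ℝ ∞ u y) :
    SmoothFun n :=
  ⟨fun θ => u (θ : Ambient n), fun θ =>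
    (hu _ (sphere_ne_zero θ)).contMDiffAt.comp θ (contMDiff_coe_sphere (n := n) θ)⟩

/-- The Laplace-Beltrami operator of the round sphere. -/
def sphereLaplacian (f : SmoothFun n) : SmoothFun n :=
  -- The extension is constant along rays, so at |y| = 1 its Euclidean Laplacian has no radial part
  -- and is the intrinsic Laplacian.
  restrictSphere (euclideanLaplacian (radialExtension f)) fun _ hy =>
    contDiffAt_euclideanLaplacian (contDiffAt_radialExtension f hy)

lemma sphereLaplacian_apply (f : SmoothFun n) (θ : Sph n) :
    sphereLaplacian f θ = euclideanLaplacian (radialExtension f) (θ : Ambient n) := rfl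

lemma euclideanLaplacian_radialExtension (f : SmoothFun n) {t : ℝ} (ht : 0 < t) (θ : Sph n) :
    euclideanLaplacian (radialExtension f) (t • (θ : Ambient n)) =
      ((t : ℂ) ^ 2)⁻¹ * sphereLaplacian f θ := by
  have ht' : (t : ℂ) ^ 2 ≠ 0 := pow_ne_zero _ (by exact_mod_cast ht.ne')
  rw [sphereLaplacian_apply, ← euclideanLaplacian_radialExtension_smul f ht (θ : Ambient n),
    inv_mul_cancel_left₀ ht']

/-- The product of a smooth function with a complex constant. -/
def smulFun (c : ℂ) (f : SmoothFun n) : SmoothFun n :=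
  restrictSphere (fun y => c * radialExtension f y) fun _ hy =>
    contDiffAt_const.mul (contDiffAt_radialExtension f hy)

@[simp] lemma smulFun_apply (c : ℂ) (f : SmoothFun n) (θ : Sph n) :
    smulFun c f θ = c * f θ := by
  rw [← radialExtension_sphere f θ]
  rfl

/-- The complex conjugate of a smooth function. -/
def conjFun (f : SmoothFun n) : SmoothFun n :=
  restrictSphere (fun y => Complex.conjCLE (radialExtension f y)) fun y hy =>
    Complex.conjCLE.contDiff.contDiffAt.comp y (contDiffAt_radialExtension f hy)

@[simp] lemma conjFun_apply (f : SmoothFun n) (θ : Sph n) :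
    conjFun f θ = (starRingEnd ℂ) (f θ) := by
  rw [← radialExtension_sphere f θ]
  rfl

@[simp] lemma add_fun_apply (f g : SmoothFun n) (θ : Sph n) : (f + g) θ = f θ + g θ := rfl

lemma smoothFun_ext {f g : SmoothFun n} (h : ∀ θ, f θ = g θ) : f = g := ContMDiffMap.ext h

lemma radialExtension_constFun (c : ℂ) {y : Ambient n} (hy : y ≠ 0) :
    radialExtension (constFun n c) y = c := by
  rw [radialExtension_eq_toSph _ hy, constFun_apply]

lemma sphereLaplacian_constFun (c : ℂ) : sphereLaplacian (constFun n c) = constFun n 0 := by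
  refine smoothFun_ext fun θ => ?_
  rw [sphereLaplacian_apply, constFun_apply]
  refine Finset.sum_eq_zero fun a _ => ?_
  have h1 : ∀ y : Ambient n, y ≠ 0 → pd a (radialExtension (constFun n c)) y = 0 := by
    intro y hy
    rw [pd_congr ((eventually_ne_zero hy).mono fun z hz => radialExtension_constFun c hz), pd_const]
  rw [pd_congr ((eventually_ne_zero (sphere_ne_zero θ)).mono h1), pd_const]

lemma pd_add {u v : Ambient n → ℂ} {y : Ambient n} (hu : DifferentiableAt ℝ u y)
    (hv : DifferentiableAt ℝ v y) (a : Fin (n + 1)) :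
    pd a (fun z => u z + v z) y = pd a u y + pd a v y := by
  unfold pd
  rw [fderiv_fun_add hu hv]
  rfl

lemma pd_mul {u v : Ambient n → ℂ} {y : Ambient n} (hu : DifferentiableAt ℝ u y)
    (hv : DifferentiableAt ℝ v y) (a : Fin (n + 1)) :
    pd a (fun z => u z * v z) y = u y * pd a v y + pd a u y * v y := by
  unfold pd
  rw [fderiv_fun_mul hu hv]
  simp
  ring

lemma sphereLaplacian_add (f g : SmoothFun n) :
    sphereLaplacian (f + g) = sphereLaplacian f + sphereLaplacian g := by
  refine smoothFun_ext fun θ => ?_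
  rw [add_fun_apply, sphereLaplacian_apply, sphereLaplacian_apply, sphereLaplacian_apply]
  unfold euclideanLaplacian
  rw [← Finset.sum_add_distrib]
  refine Finset.sum_congr rfl fun a _ => ?_
  have h0 : radialExtension (f + g : SmoothFun n) =
      fun z => radialExtension f z + radialExtension g z := by
    funext y
    by_cases hy : y = 0
    · simp [hy, radialExtension_zero]
    · simp [radialExtension_eq_toSph _ hy]
  have h1 : ∀ y : Ambient n, y ≠ 0 → pd a (radialExtension (f + g : SmoothFun n)) y =
      pd a (radialExtension f) y + pd a (radialExtension g) y := by
    intro y hy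
    rw [h0, pd_add (differentiableAt_of_contDiffAt_infty (contDiffAt_radialExtension f hy))
      (differentiableAt_of_contDiffAt_infty (contDiffAt_radialExtension g hy))]
  have hθ := sphere_ne_zero θ
  rw [pd_congr ((eventually_ne_zero hθ).mono h1),
    pd_add (differentiableAt_of_contDiffAt_infty
        (contDiffAt_pd (contDiffAt_radialExtension f hθ) a))
      (differentiableAt_of_contDiffAt_infty
        (contDiffAt_pd (contDiffAt_radialExtension g hθ) a))]

lemma sphereLaplacian_smulFun (c : ℂ) (f : SmoothFun n) :
    sphereLaplacian (smulFun c f) = smulFun c (sphereLaplacian f) := by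
  refine smoothFun_ext fun θ => ?_
  rw [smulFun_apply, sphereLaplacian_apply, sphereLaplacian_apply]
  unfold euclideanLaplacian
  rw [Finset.mul_sum]
  refine Finset.sum_congr rfl fun a _ => ?_
  have h0 : radialExtension (smulFun c f) = fun z => c * radialExtension f z := by
    funext y
    by_cases hy : y = 0
    · simp [hy, radialExtension_zero]
    · simp [radialExtension_eq_toSph _ hy]
  have h1 : pd a (radialExtension (smulFun c f)) = fun y => c * pd a (radialExtension f) y := by
    funext y
    rw [h0, pd_const_mul]
  rw [h1, pd_const_mul]

/-! ### The Laplacian of the sphere is formally self-adjoint -/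

open MeasureTheory

lemma integral_pd_eq_zero {W : Ambient n → ℂ} (hW : ContDiff ℝ ∞ W) (hc : HasCompactSupport W)
    (a : Fin (n + 1)) : ∫ y, pd a W y = 0 := by
  have hd : Continuous fun y => fderiv ℝ W y (EuclideanSpace.single a 1) :=
    (hW.continuous_fderiv (by simp)).clm_apply continuous_const
  have hdc : HasCompactSupport fun y => fderiv ℝ W y (EuclideanSpace.single a 1) :=
    hc.fderiv_apply ℝ _
  have h := integral_mul_fderiv_eq_neg_fderiv_mul_of_integrable (μ := (volume : Measure (Ambient n)))
    (f := fun _ => (1 : ℂ)) (g := W) (v := EuclideanSpace.single a 1)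
    (by simp) (by simpa using hd.integrable_of_hasCompactSupport hdc)
    (by simpa using hW.continuous.integrable_of_hasCompactSupport hc)
    (fun _ _ => differentiableAt_const _) (fun y _ => hW.contDiffAt.differentiableAt (by simp))
  simpa [pd] using h

instance : IsFiniteMeasure (sphereMeasure n) := by
  unfold sphereMeasure
  infer_instance

instance : (sphereMeasure n).IsOpenPosMeasure := by
  unfold sphereMeasure
  infer_instance

/-- Polar coordinates: off the origin Lebesgue measure is the product of the sphere measure and r^n
dr, and the integrand separates. -/
lemma integral_norm_mul_radialExtension (ρ : ℝ → ℂ) (k : Sph n → ℂ) :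
    ∫ y : Ambient n, ρ ‖y‖ * radialExtension k y =
      (∫ θ, k θ ∂(sphereMeasure n)) *
        ∫ r : Set.Ioi (0 : ℝ), ρ r ∂(Measure.volumeIoiPow n) := by
  have hdim : Module.finrank ℝ (Ambient n) - 1 = n := by simp
  have hpres := (volume : Measure (Ambient n)).measurePreserving_homeomorphUnitSphereProd
  rw [hdim] at hpres
  calc ∫ y : Ambient n, ρ ‖y‖ * radialExtension k y
      = ∫ y : ({(0 : Ambient n)}ᶜ : Set (Ambient n)), ρ ‖(y : Ambient n)‖ *
          radialExtension k (y : Ambient n) ∂((volume : Measure (Ambient n)).comap (↑)) := by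
        rw [integral_subtype_comap (measurableSet_singleton _).compl
          fun y : Ambient n => ρ ‖y‖ * radialExtension k y, restrict_compl_singleton]
    _ = ∫ p, k p.1 * ρ p.2 ∂((sphereMeasure n).prod (Measure.volumeIoiPow n)) := by
        rw [sphereMeasure, ← hpres.integral_comp (Homeomorph.measurableEmbedding _)]
        refine integral_congr_ae (Filter.Eventually.of_forall fun y => ?_)
        have hy : (y : Ambient n) ≠ 0 := y.2
        simp only [homeomorphUnitSphereProd_apply_snd_coe]
        rw [mul_comm, radialExtension_of_ne k hy]
        simp
    _ = _ := integral_prod_mul (L := ℂ) k fun r : Set.Ioi (0 : ℝ) => ρ r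

/-- A radial cutoff function. -/
def radialBump : ContDiffBump (2 : ℝ) := ⟨1 / 2, 1, by norm_num, by norm_num⟩

/-- Centre 2 and outer radius 1 keep the bump away from the origin, where radial extensions are
singular. -/
lemma radialBump_eq_zero {r : ℝ} (hr : r ≤ 1 ∨ 3 ≤ r) : radialBump r = 0 := by
  apply radialBump.zero_of_le_dist
  show (1 : ℝ) ≤ dist r 2
  rw [Real.dist_eq, le_abs]
  rcases hr with hr | hr
  · right; linarith
  · left; linarith

/-- The polar formula with k = 1 exhibits this integral as a factor of a strictly positive Euclidean
integral. -/
lemma integral_radialBump_ne_zero :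
    ∫ r : Set.Ioi (0 : ℝ), ((radialBump r : ℝ) : ℂ) ∂(Measure.volumeIoiPow n) ≠ 0 := by
  have h := integral_norm_mul_radialExtension (n := n) (fun r => ((radialBump r : ℝ) : ℂ))
    (fun _ => 1)
  have hcont : Continuous fun y : Ambient n => radialBump ‖y‖ :=
    radialBump.continuous.comp continuous_norm
  have hcomp : HasCompactSupport fun y : Ambient n => radialBump ‖y‖ := by
    refine HasCompactSupport.intro (isCompact_closedBall (0 : Ambient n) 3) fun y hy => ?_
    rw [Metric.mem_closedBall, dist_zero_right, not_le] at hy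
    exact radialBump_eq_zero (Or.inr hy.le)
  have hpos : 0 < ∫ y : Ambient n, radialBump ‖y‖ := by
    refine hcont.integral_pos_of_hasCompactSupport_nonneg_nonzero hcomp
      (fun y => radialBump.nonneg) (x := (2 : ℝ) • EuclideanSpace.single 0 1) ?_
    have : ‖(2 : ℝ) • (EuclideanSpace.single 0 1 : Ambient n)‖ = 2 := by simp [norm_smul]
    rw [this, radialBump.one_of_mem_closedBall]
    · exact one_ne_zero
    · simp [radialBump]
  have hl : ∫ y : Ambient n, ((radialBump ‖y‖ : ℝ) : ℂ) * radialExtension (fun _ => 1) y =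
      ((∫ y : Ambient n, radialBump ‖y‖ : ℝ) : ℂ) := by
    rw [← integral_complex_ofReal]
    refine integral_congr_ae (Filter.Eventually.of_forall fun y => ?_)
    by_cases hy : y = 0
    · simp [hy, radialBump_eq_zero (r := 0) (by norm_num)]
    · simp [radialExtension_eq_toSph _ hy]
  rw [hl] at h
  intro h0
  rw [h0, mul_zero] at h
  exact hpos.ne' (by exact_mod_cast h)

/-- The smooth radial function `χ(|y|) |y|²`. -/
def radialCutoff (y : Ambient n) : ℂ := ((radialBump ‖y‖ * ‖y‖ ^ 2 : ℝ) : ℂ)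

lemma radialCutoff_eq_zero {y : Ambient n} (hy : ‖y‖ ≤ 1 ∨ 3 ≤ ‖y‖) : radialCutoff y = 0 := by
  simp [radialCutoff, radialBump_eq_zero hy]

lemma radialCutoff_eventuallyEq_zero : (radialCutoff : Ambient n → ℂ) =ᶠ[𝓝 0] fun _ => 0 := by
  filter_upwards [Metric.ball_mem_nhds (0 : Ambient n) one_pos] with y hy
  rw [mem_ball_zero_iff] at hy
  exact radialCutoff_eq_zero (Or.inl hy.le)

lemma pd_radial {ψ : ℝ → ℂ} {y : Ambient n} (hy : y ≠ 0) {ψ' : ℂ}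
    (hψ : HasDerivAt ψ ψ' ‖y‖) (a : Fin (n + 1)) :
    pd a (fun z : Ambient n => ψ ‖z‖) y = ψ' / (‖y‖ : ℂ) * (y a : ℂ) := by
  have hy' : ‖y‖ ≠ 0 := norm_ne_zero_iff.2 hy
  have h2 : HasFDerivAt (fun z : Ambient n => ‖z‖) ((1 / (2 * ‖y‖)) • (2 : ℕ) • innerSL ℝ y) y := by
    have h := (hasStrictFDerivAt_norm_sq y).hasFDerivAt.sqrt (pow_ne_zero 2 hy')
    simpa only [Real.sqrt_sq (norm_nonneg _)] using h
  have h3 := hψ.hasFDerivAt.comp y h2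
  have h4 : fderiv ℝ (fun z : Ambient n => ψ ‖z‖) y = _ := h3.fderiv
  rw [pd, h4]
  simp [EuclideanSpace.inner_single_right]
  have : (‖y‖ : ℂ) ≠ 0 := by exact_mod_cast hy'
  field_simp

lemma contDiffAt_radialCutoff {y : Ambient n} (hy : y ≠ 0) :
    ContDiffAt ℝ ∞ (radialCutoff : Ambient n → ℂ) y := by
  unfold radialCutoff
  refine Complex.ofRealCLM.contDiff.contDiffAt.comp y ?_
  exact (radialBump.contDiffAt.comp y (contDiffAt_norm ℝ hy)).mul ((contDiffAt_norm ℝ hy).pow 2)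

/-- The gradient of a radial function is parallel to y, hence orthogonal to ∇F by Euler's identity.
-/
lemma sum_pd_radialCutoff_mul (f : SmoothFun n) {y : Ambient n} (hy : y ≠ 0) :
    ∑ a, pd a radialCutoff y * pd a (radialExtension f) y = 0 := by
  have hd : DifferentiableAt ℝ (fun r : ℝ => ((radialBump r * r ^ 2 : ℝ) : ℂ)) ‖y‖ := by
    refine Complex.ofRealCLM.differentiableAt.comp _ ?_
    exact ((radialBump.contDiff (n := 1)).differentiable (by simp) _).mul
      (differentiableAt_id.pow 2)
  have h : ∀ a, pd a radialCutoff y = _ := fun a => pd_radial hy hd.hasDerivAt a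
  simp only [h, mul_assoc]
  rw [← Finset.mul_sum, sum_mul_pd_radialExtension f hy, mul_zero]

/-- The divergence theorem for `χ(|y|) |y|² (G ∇F - F ∇G)`. -/
lemma integral_radialCutoff_mul (f φ : SmoothFun n) :
    ∫ y : Ambient n, radialCutoff y *
      (euclideanLaplacian (radialExtension f) y * radialExtension φ y -
        radialExtension f y * euclideanLaplacian (radialExtension φ) y) = 0 := by
  set F := radialExtension f with hF
  set G := radialExtension φ with hG
  let W : Fin (n + 1) → Ambient n → ℂ := fun a y =>
    radialCutoff y * (pd a F y * G y + -1 * (F y * pd a G y))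
  have hF' : ∀ y : Ambient n, y ≠ 0 → ContDiffAt ℝ ∞ F y := fun y hy =>
    contDiffAt_radialExtension f hy
  have hG' : ∀ y : Ambient n, y ≠ 0 → ContDiffAt ℝ ∞ G y := fun y hy =>
    contDiffAt_radialExtension φ hy
  have hW0 : ∀ a, W a =ᶠ[𝓝 0] fun _ => 0 := fun a => by
    filter_upwards [radialCutoff_eventuallyEq_zero] with y hy
    simp only [W, hy, zero_mul]
  have hVc : ∀ a, ∀ y : Ambient n, y ≠ 0 →
      ContDiffAt ℝ ∞ (fun y => pd a F y * G y + -1 * (F y * pd a G y)) y := fun a y hy =>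
    ((contDiffAt_pd (hF' y hy) a).mul (hG' y hy)).add
      (contDiffAt_const.mul ((hF' y hy).mul (contDiffAt_pd (hG' y hy) a)))
  have hWc : ∀ a, ContDiff ℝ ∞ (W a) := fun a => by
    rw [contDiff_iff_contDiffAt]
    intro y
    by_cases hy : y = 0
    · rw [hy]
      exact contDiffAt_const.congr_of_eventuallyEq (hW0 a)
    · exact (contDiffAt_radialCutoff hy).mul (hVc a y hy)
  have hWs : ∀ a, HasCompactSupport (W a) := fun a => by
    refine HasCompactSupport.intro (isCompact_closedBall (0 : Ambient n) 3) fun y hy => ?_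
    rw [Metric.mem_closedBall, dist_zero_right, not_le] at hy
    simp only [W, radialCutoff_eq_zero (Or.inr hy.le), zero_mul]
  have hdiv : ∀ y : Ambient n, ∑ a, pd a (W a) y = radialCutoff y *
      (euclideanLaplacian F y * G y - F y * euclideanLaplacian G y) := by
    intro y
    by_cases hy : y = 0
    · rw [hy, radialCutoff_eq_zero (by simp), zero_mul]
      refine Finset.sum_eq_zero fun a _ => ?_
      rw [pd_congr (hW0 a), pd_const]
    · have hFd := differentiableAt_of_contDiffAt_infty (hF' y hy)
      have hGd := differentiableAt_of_contDiffAt_infty (hG' y hy)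
      have hFd2 := fun a => differentiableAt_of_contDiffAt_infty (contDiffAt_pd (hF' y hy) a)
      have hGd2 := fun a => differentiableAt_of_contDiffAt_infty (contDiffAt_pd (hG' y hy) a)
      -- The products ∂F ∂G cancel; the last two terms pair the gradient of the cutoff with ∇F and
      -- ∇G and sum to zero.
      have hterm : ∀ a, pd a (W a) y = radialCutoff y * (pd a (pd a F) y * G y) -
          radialCutoff y * (F y * pd a (pd a G) y) +
          G y * (pd a radialCutoff y * pd a F y) - F y * (pd a radialCutoff y * pd a G y) := by
        intro a
        simp only [W]
        rw [pd_mul (differentiableAt_of_contDiffAt_infty (contDiffAt_radialCutoff hy))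
            (differentiableAt_of_contDiffAt_infty (hVc a y hy)),
          pd_add ((hFd2 a).fun_mul hGd) ((hFd.fun_mul (hGd2 a)).const_mul _), pd_const_mul,
          pd_mul (hFd2 a) hGd, pd_mul hFd (hGd2 a)]
        ring
      have hz : ∀ u : SmoothFun n, ∀ c : ℂ,
          ∑ a, c * (pd a radialCutoff y * pd a (radialExtension u) y) = 0 := by
        intro u c
        rw [← Finset.mul_sum, sum_pd_radialCutoff_mul u hy, mul_zero]
      simp only [hterm]
      rw [Finset.sum_sub_distrib, Finset.sum_add_distrib, Finset.sum_sub_distrib, hz f, hz φ]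
      simp only [euclideanLaplacian, ← Finset.mul_sum, ← Finset.sum_mul]
      ring
  simp only [← hdiv]
  rw [integral_finsetSum _ fun a _ => ?_]
  · exact Finset.sum_eq_zero fun a _ => integral_pd_eq_zero (hWc a) (hWs a) a
  · exact (((hWc a).continuous_fderiv (by simp)).clm_apply
      continuous_const).integrable_of_hasCompactSupport ((hWs a).fderiv_apply ℝ _)

lemma smoothFun_integrable (f g : SmoothFun n) :
    Integrable (fun θ => f θ * g θ) (sphereMeasure n) := by
  exact (f.contMDiff.continuous.mul g.contMDiff.continuous).integrable_of_hasCompactSupport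
    (HasCompactSupport.of_compactSpace _)

/-- The Laplacian of the round sphere is formally self-adjoint. -/
theorem isFormalAdjoint_sphereLaplacian :
    IsFormalAdjoint (sphereLaplacian (n := n)) sphereLaplacian := by
  intro f φ
  have h := integral_norm_mul_radialExtension (n := n) (fun r => ((radialBump r : ℝ) : ℂ))
    (fun θ => sphereLaplacian f θ * φ θ - f θ * sphereLaplacian φ θ)
  -- The weight |y|² in the cutoff compensates the degree -2 of the Laplacians, so the integrand is
  -- a bump in |y| times a degree-0 function; the nonzero radial integral can then be cancelled.
  have h0 : ∫ y : Ambient n, ((radialBump ‖y‖ : ℝ) : ℂ) *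
      radialExtension (fun θ => sphereLaplacian f θ * φ θ - f θ * sphereLaplacian φ θ) y = 0 := by
    rw [← integral_radialCutoff_mul f φ]
    refine integral_congr_ae (Filter.Eventually.of_forall fun y => ?_)
    by_cases hy : y = 0
    · simp [hy, radialBump_eq_zero (r := 0) (by norm_num), radialCutoff]
    · have hpos : 0 < ‖y‖ := norm_pos_iff.2 hy
      have hy2 : y = ‖y‖ • (toSph hy : Ambient n) := by
        simp [toSph, smul_smul, mul_inv_cancel₀ hpos.ne']
      have e1 : ∀ u : SmoothFun n, euclideanLaplacian (radialExtension u) y =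
          ((‖y‖ : ℂ) ^ 2)⁻¹ * sphereLaplacian u (toSph hy) := by
        intro u
        conv_lhs => rw [hy2]
        exact euclideanLaplacian_radialExtension u hpos _
      have hne : (‖y‖ : ℂ) ≠ 0 := by exact_mod_cast hpos.ne'
      simp only [e1, radialExtension_eq_toSph _ hy, radialCutoff]
      push_cast
      field_simp
  rw [h0] at h
  have h1 := (mul_eq_zero.1 h.symm).resolve_right integral_radialBump_ne_zero
  rw [integral_sub (smoothFun_integrable _ _) (smoothFun_integrable _ _)] at h1
  exact sub_eq_zero.1 h1

/-! ### The Laplacian of the Poincaré metric on the collar -/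

lemma sqrt_det_poincareMetric {y : Ambient n} (hy : ‖y‖ < 1) :
    Real.sqrt (poincareMetric n y).det = (2 * (1 - ‖y‖ ^ 2)⁻¹) ^ (n + 1) := by
  have h0 := one_sub_normSq_pos hy
  rw [poincareMetric, Matrix.det_smul, Matrix.det_one, mul_one, Fintype.card_fin,
    show (4 / (1 - ‖y‖ ^ 2) ^ 2 : ℝ) = (2 * (1 - ‖y‖ ^ 2)⁻¹) ^ 2 by
      rw [mul_pow, inv_pow, div_eq_mul_inv]; norm_num, pow_right_comm _ 2 (n + 1),
    Real.sqrt_sq (by positivity)]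

/-- The Laplacian of the Poincaré metric in terms of Euclidean derivatives. -/
lemma laplaceBeltrami_poincareMetric (hn : 1 ≤ n) {u : Ambient n → ℂ} {y : Ambient n}
    (hy : ‖y‖ < 1) (hu : ContDiffAt ℝ ∞ u y) :
    laplaceBeltrami (poincareMetric n) u y =
      ((1 - (‖y‖ : ℂ) ^ 2) / 2) ^ 2 * (euclideanLaplacian u y +
        2 * (n - 1) / (1 - (‖y‖ : ℂ) ^ 2) * ∑ a, (y a : ℂ) * pd a u y) := by
  obtain ⟨m, rfl⟩ : ∃ m, n = m + 1 := ⟨n - 1, by omega⟩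
  have h0 := (one_sub_normSq_pos hy).ne'
  have h0' : (1 - (‖y‖ : ℂ) ^ 2) ≠ 0 := by exact_mod_cast h0
  -- With φ = 2/(1-|z|²), √det g · g^{ab} = φ^{n+1} φ^{-2} δ_{ab} = φ^m δ_{ab}; writing n = m+1
  -- keeps the exponent a natural number.
  have hflux : ∀ a, (fun z => ∑ b, ((Real.sqrt (poincareMetric (m + 1) z).det *
      (poincareMetric (m + 1) z)⁻¹ a b : ℝ) : ℂ) * pd b u z) =ᶠ[𝓝 y]
      fun z => (((2 * (1 - ‖z‖ ^ 2)⁻¹) ^ m : ℝ) : ℂ) * pd a u z := by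
    intro a
    filter_upwards [eventually_norm_lt_one hy] with z hz
    have hz0 := (one_sub_normSq_pos hz).ne'
    rw [sqrt_det_poincareMetric hz, poincareMetric_inv hz,
      Finset.sum_eq_single a (fun b _ hb => by simp [Matrix.one_apply_ne hb.symm]) (by simp)]
    congr 2
    have hone : 2 * (1 - ‖z‖ ^ 2)⁻¹ * (2 * (1 - ‖z‖ ^ 2)⁻¹ * ((1 - ‖z‖ ^ 2) ^ 2 / 4)) = 1 := by
      field_simp
      norm_num
    rw [Matrix.smul_apply, Matrix.one_apply_eq, smul_eq_mul, mul_one, pow_succ, pow_succ,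
      mul_assoc, mul_assoc, hone, mul_one]
  have hm : HasDerivAt (fun s : ℝ => (2 * (1 - s)⁻¹) ^ m)
      (m * (2 * (1 - ‖y‖ ^ 2)⁻¹) ^ m * (1 - ‖y‖ ^ 2)⁻¹) (‖y‖ ^ 2) := by
    refine (((hasDerivAt_inv_one_sub h0).const_mul 2).fun_pow m).congr_deriv ?_
    rcases m with _ | m
    · simp
    · simp only [Nat.add_sub_cancel, pow_succ]
      field_simp
  have hd : DifferentiableAt ℝ (fun z : Ambient (m + 1) => (2 * (1 - ‖z‖ ^ 2)⁻¹) ^ m) y := by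
    have h := hm.comp_hasFDerivAt y (hasStrictFDerivAt_norm_sq y).hasFDerivAt
    exact h.differentiableAt
  have hdm : DifferentiableAt ℝ (fun z : Ambient (m + 1) =>
      (((2 * (1 - ‖z‖ ^ 2)⁻¹) ^ m : ℝ) : ℂ)) y :=
    Complex.ofRealCLM.differentiableAt.comp y hd
  have hpdm : ∀ a, pd a (fun z : Ambient (m + 1) => (((2 * (1 - ‖z‖ ^ 2)⁻¹) ^ m : ℝ) : ℂ)) y =
      ((m * (2 * (1 - ‖y‖ ^ 2)⁻¹) ^ m * (1 - ‖y‖ ^ 2)⁻¹ * (2 * y a) : ℝ) : ℂ) := by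
    intro a
    rw [← pd_comp_normSq hm a]
    have h := (Complex.ofRealCLM.hasFDerivAt.comp y hd.hasFDerivAt).fderiv
    have h' : fderiv ℝ (fun z : Ambient (m + 1) => (((2 * (1 - ‖z‖ ^ 2)⁻¹) ^ m : ℝ) : ℂ)) y = _ := h
    rw [pd, h']
    rfl
  unfold laplaceBeltrami
  have hterm : ∀ a, pd a (fun z => ∑ b, ((Real.sqrt (poincareMetric (m + 1) z).det *
      (poincareMetric (m + 1) z)⁻¹ a b : ℝ) : ℂ) * pd b u z) y =
      (2 * (1 - (‖y‖ : ℂ) ^ 2)⁻¹) ^ m * pd a (pd a u) y +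
        (2 * (1 - (‖y‖ : ℂ) ^ 2)⁻¹) ^ m * (2 * m * (1 - (‖y‖ : ℂ) ^ 2)⁻¹) *
          ((y a : ℂ) * pd a u y) := by
    intro a
    rw [pd_congr (hflux a), pd_mul hdm (differentiableAt_of_contDiffAt_infty (contDiffAt_pd hu a)),
      hpdm]
    push_cast
    ring
  simp only [hterm]
  rw [Finset.sum_add_distrib, ← Finset.mul_sum, ← Finset.mul_sum, sqrt_det_poincareMetric hy]
  change _ * (_ * euclideanLaplacian u y + _) = _
  push_cast
  have hP : (2 * (1 - (‖y‖ : ℂ) ^ 2)⁻¹) ^ m ≠ 0 :=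
    pow_ne_zero _ (mul_ne_zero two_ne_zero (inv_ne_zero h0'))
  rw [pow_succ, pow_succ]
  generalize (2 * (1 - (‖y‖ : ℂ) ^ 2)⁻¹) ^ m = P at hP ⊢
  field_simp
  ring

/-- Product rule with the radial Laplacian ψ'' + nψ'/|y|; the cross term 2∇ψ·∇F and the radial
derivative of F vanish by Euler's identity. -/
lemma euclideanLaplacian_radial_mul (f : SmoothFun n) {y : Ambient n} (hy : y ≠ 0)
    {ψ ψ₁ : ℝ → ℂ} {ψ₂ : ℂ} (h₁ : ∀ᶠ q in 𝓝 ‖y‖, HasDerivAt ψ (ψ₁ q) q)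
    (h₂ : HasDerivAt ψ₁ ψ₂ ‖y‖) :
    euclideanLaplacian (fun z => ψ ‖z‖ * radialExtension f z) y =
        (ψ₂ + n * ψ₁ ‖y‖ / ‖y‖) * radialExtension f y +
          ψ ‖y‖ * euclideanLaplacian (radialExtension f) y ∧
      ∑ a, (y a : ℂ) * pd a (fun z => ψ ‖z‖ * radialExtension f z) y =
        ‖y‖ * ψ₁ ‖y‖ * radialExtension f y := by
  have hq : (‖y‖ : ℂ) ≠ 0 := by exact_mod_cast norm_ne_zero_iff.2 hy
  have hsq : ∑ a, (y a : ℂ) * (y a : ℂ) = (‖y‖ : ℂ) ^ 2 := by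
    rw [← Complex.ofReal_pow, EuclideanSpace.real_norm_sq_eq]
    push_cast
    exact Finset.sum_congr rfl fun a _ => by ring
  set F := radialExtension f with hF
  have hradial : ∀ {z : Ambient n} {φ : ℝ → ℂ} {φ' : ℂ}, z ≠ 0 → HasDerivAt φ φ' ‖z‖ →
      DifferentiableAt ℝ (fun z : Ambient n => φ ‖z‖) z := fun {z φ φ'} hz h =>
    h.differentiableAt.comp z ((contDiffAt_norm (n := 1) ℝ hz).differentiableAt (by simp))
  have hFd : ∀ z : Ambient n, z ≠ 0 → DifferentiableAt ℝ F z := fun z hz =>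
    differentiableAt_of_contDiffAt_infty (contDiffAt_radialExtension f hz)
  have hpd : ∀ᶠ z in 𝓝 y, ∀ a, pd a (fun z => ψ ‖z‖ * F z) z =
      ψ₁ ‖z‖ / ‖z‖ * ((z a : ℂ) * F z) + ψ ‖z‖ * pd a F z := by
    filter_upwards [continuous_norm.continuousAt.eventually h₁, eventually_ne_zero hy]
      with z hz hz0 a
    rw [pd_mul (hradial hz0 hz) (hFd z hz0), pd_radial hz0 hz]
    ring
  have hcoordd : ∀ a, DifferentiableAt ℝ (fun z : Ambient n => (z a : ℂ)) y := fun a =>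
    Complex.ofRealCLM.differentiableAt.comp y
      (EuclideanSpace.proj a : Ambient n →L[ℝ] ℝ).differentiableAt
  have hcoord : ∀ a, pd a (fun z : Ambient n => (z a : ℂ)) y = 1 := by
    intro a
    have h : HasFDerivAt (fun z : Ambient n => (z a : ℂ))
        (Complex.ofRealCLM.comp (EuclideanSpace.proj a : Ambient n →L[ℝ] ℝ)) y :=
      (Complex.ofRealCLM.comp (EuclideanSpace.proj a : Ambient n →L[ℝ] ℝ)).hasFDerivAt
    rw [pd, h.fderiv]
    simp
  have hinv : HasDerivAt (fun q : ℝ => (q : ℂ)) 1 ‖y‖ := Complex.ofRealCLM.hasDerivAt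
  have hχ := h₂.fun_div hinv hq
  have heuler := sum_mul_pd_radialExtension f hy
  constructor
  · have hterm : ∀ a, pd a (pd a (fun z => ψ ‖z‖ * F z)) y =
        (ψ₂ * ‖y‖ - ψ₁ ‖y‖) / (‖y‖ : ℂ) ^ 2 / ‖y‖ * F y * ((y a : ℂ) * (y a : ℂ)) +
          ψ₁ ‖y‖ / ‖y‖ * F y + 2 * (ψ₁ ‖y‖ / ‖y‖) * ((y a : ℂ) * pd a F y) +
          ψ ‖y‖ * pd a (pd a F) y := by
      intro a
      have hFa := differentiableAt_of_contDiffAt_infty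
        (contDiffAt_pd (contDiffAt_radialExtension f hy) a)
      have hψd := hradial hy h₁.self_of_nhds
      rw [pd_congr (hpd.mono fun z hz => hz a),
        pd_add ((hradial hy hχ).fun_mul ((hcoordd a).fun_mul (hFd y hy))) (hψd.fun_mul hFa),
        pd_mul (hradial hy hχ) ((hcoordd a).fun_mul (hFd y hy)), pd_mul (hcoordd a) (hFd y hy),
        pd_mul hψd hFa, pd_radial hy hχ, pd_radial hy h₁.self_of_nhds, hcoord]
      ring
    have hsum : euclideanLaplacian (fun z => ψ ‖z‖ * F z) y =
        ∑ a, pd a (pd a (fun z => ψ ‖z‖ * F z)) y := rfl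
    rw [hsum]
    simp only [hterm]
    rw [Finset.sum_add_distrib, Finset.sum_add_distrib, Finset.sum_add_distrib, ← Finset.mul_sum,
      ← Finset.mul_sum, ← Finset.mul_sum, ← Finset.mul_sum, hsq, heuler]
    simp only [euclideanLaplacian, Finset.sum_const, Finset.card_univ, Fintype.card_fin,
      nsmul_eq_mul]
    push_cast
    field_simp
    ring
  · have hterm : ∀ a, (y a : ℂ) * pd a (fun z => ψ ‖z‖ * F z) y =
        ψ₁ ‖y‖ / ‖y‖ * F y * ((y a : ℂ) * (y a : ℂ)) + ψ ‖y‖ * ((y a : ℂ) * pd a F y) := by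
      intro a
      rw [hpd.self_of_nhds]
      ring
    simp only [hterm]
    rw [Finset.sum_add_distrib, ← Finset.mul_sum, ← Finset.mul_sum, hsq, heuler]
    field_simp
    ring

/-! ### Complex powers of the collar coordinate -/

/-- The coordinate `r` of the collar as a function of `|y|`. -/
def radiusFun (q : ℝ) : ℝ := 2 * (1 - q) / (1 + q)

lemma radiusFun_pos {q : ℝ} (hq : q ∈ Set.Ioo (0 : ℝ) 1) : 0 < radiusFun q :=
  div_pos (by linarith [hq.2]) (by linarith [hq.1])

lemma hasDerivAt_radiusFun {q : ℝ} (hq : q ∈ Set.Ioo (0 : ℝ) 1) :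
    HasDerivAt radiusFun (-4 / (1 + q) ^ 2) q := by
  have h1 : 1 + q ≠ 0 := by linarith [hq.1]
  refine ((((hasDerivAt_id' q).const_sub 1).const_mul 2).fun_div
    ((hasDerivAt_id' q).const_add 1) h1).congr_deriv ?_
  ring

lemma hasDerivAt_radiusFun_cpow (κ : ℂ) {q : ℝ} (hq : q ∈ Set.Ioo (0 : ℝ) 1) :
    HasDerivAt (fun q : ℝ => ((radiusFun q : ℝ) : ℂ) ^ κ)
      (κ * ((radiusFun q : ℝ) : ℂ) ^ (κ - 1) * ((-4 / (1 + q) ^ 2 : ℝ) : ℂ)) q := by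
  have h1 : HasDerivAt (fun z : ℂ => z ^ κ) (κ * ((radiusFun q : ℝ) : ℂ) ^ (κ - 1))
      ((radiusFun q : ℝ) : ℂ) :=
    (hasDerivAt_id' _).cpow_const
      (Complex.ofReal_mem_slitPlane.2 (radiusFun_pos hq)) |>.congr_deriv (by ring)
  exact h1.comp q (hasDerivAt_radiusFun hq).ofReal_comp

lemma hasDerivAt_deriv_radiusFun_cpow (κ : ℂ) {q : ℝ} (hq : q ∈ Set.Ioo (0 : ℝ) 1) :
    HasDerivAt (fun q : ℝ => κ * ((radiusFun q : ℝ) : ℂ) ^ (κ - 1) *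
        ((-4 / (1 + q) ^ 2 : ℝ) : ℂ))
      (κ * ((κ - 1) * ((radiusFun q : ℝ) : ℂ) ^ (κ - 1 - 1) * ((-4 / (1 + q) ^ 2 : ℝ) : ℂ)) *
          ((-4 / (1 + q) ^ 2 : ℝ) : ℂ) +
        κ * ((radiusFun q : ℝ) : ℂ) ^ (κ - 1) * ((8 / (1 + q) ^ 3 : ℝ) : ℂ)) q := by
  have h1 : 1 + q ≠ 0 := by linarith [hq.1]
  have h2 : HasDerivAt (fun q : ℝ => -4 / (1 + q) ^ 2) (8 / (1 + q) ^ 3) q := by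
    refine ((hasDerivAt_const q (-4 : ℝ)).fun_div (((hasDerivAt_id' q).const_add 1).fun_pow 2)
      (pow_ne_zero 2 h1)).congr_deriv ?_
    field_simp
    ring
  exact ((hasDerivAt_radiusFun_cpow (κ - 1) hq).const_mul κ).mul h2.ofReal_comp

/-! ### Formal solutions -/

lemma norm_collar {r : ℝ} (hr : r ∈ Set.Ioo (0 : ℝ) 2) (θ : Sph n) :
    ‖collar n (r, (θ : Ambient n))‖ = (2 - r) / (2 + r) := by
  have h : 0 ≤ (2 - r) / (2 + r) := div_nonneg (by linarith [hr.2]) (by linarith [hr.1])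
  rw [← abs_of_nonneg h, ← abs_of_nonneg (norm_nonneg (collar n (r, (θ : Ambient n)))),
    ← sq_eq_sq_iff_abs_eq_abs, norm_collar_sq]

lemma radiusFun_collar {r : ℝ} (hr : r ∈ Set.Ioo (0 : ℝ) 2) :
    radiusFun ((2 - r) / (2 + r)) = r := by
  have h2 : 2 + r ≠ 0 := by linarith [hr.1]
  have h3 : 1 + (2 - r) / (2 + r) = 4 / (2 + r) := by
    field_simp
    ring
  rw [radiusFun, h3]
  field_simp
  ring

/-- `(1 - r²/4)² (Δ + lam (n - lam))` applied to `r^κ f`, for the Euclidean form of `Δ`. -/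
lemma collar_term (f : SmoothFun n) (lam κ : ℂ) {r : ℝ} (hr : r ∈ Set.Ioo (0 : ℝ) 2)
    (θ : Sph n) {y : Ambient n} (hy : y = collar n (r, (θ : Ambient n))) :
    (((1 - (‖y‖ : ℂ) ^ 2) / 2) ^ 2 *
          (euclideanLaplacian (fun z => ((collarRadius z : ℝ) : ℂ) ^ κ * radialExtension f z) y +
        2 * (n - 1) / (1 - (‖y‖ : ℂ) ^ 2) * ∑ a, (y a : ℂ) *
          pd a (fun z => ((collarRadius z : ℝ) : ℂ) ^ κ * radialExtension f z) y) +
        lam * (n - lam) * (((collarRadius y : ℝ) : ℂ) ^ κ * radialExtension f y)) *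
        (1 - (r : ℂ) ^ 2 / 4) ^ 2 =
      (r : ℂ) ^ κ * ((κ * (κ - n) + lam * (n - lam)) * f θ * (1 - (r : ℂ) ^ 2 / 4) ^ 2 -
        n * κ / 2 * f θ * ((r : ℂ) ^ 2 * (1 - (r : ℂ) ^ 2 / 4)) +
        sphereLaplacian f θ * (r : ℂ) ^ 2) := by
  set q : ℝ := (2 - r) / (2 + r) with hq
  have hr0 : r ≠ 0 := hr.1.ne'
  have hqI : q ∈ Set.Ioo (0 : ℝ) 1 := by
    constructor
    · exact div_pos (by linarith [hr.2]) (by linarith [hr.1])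
    · rw [hq, div_lt_one (by linarith [hr.1])]
      linarith [hr.1]
  have hny : ‖y‖ = q := by rw [hy, norm_collar hr]
  have hy0 : y ≠ 0 := by
    rw [← norm_ne_zero_iff, hny]
    exact hqI.1.ne'
  have hFy : radialExtension f y = f θ := by
    rw [hy, collar, radialExtension_smul f hqI.1, radialExtension_sphere]
  have hLy : euclideanLaplacian (radialExtension f) y =
      ((q : ℂ) ^ 2)⁻¹ * sphereLaplacian f θ := by
    rw [hy, collar, euclideanLaplacian_radialExtension f hqI.1]
  have hev : ∀ᶠ p in 𝓝 ‖y‖, HasDerivAt (fun q : ℝ => ((radiusFun q : ℝ) : ℂ) ^ κ)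
      (κ * ((radiusFun p : ℝ) : ℂ) ^ (κ - 1) * ((-4 / (1 + p) ^ 2 : ℝ) : ℂ)) p := by
    rw [hny]
    filter_upwards [Ioo_mem_nhds hqI.1 hqI.2] with p hp
    exact hasDerivAt_radiusFun_cpow κ hp
  obtain ⟨h1, h2⟩ := euclideanLaplacian_radial_mul f hy0 hev
    (hasDerivAt_deriv_radiusFun_cpow κ (hny ▸ hqI))
  have hrad : ∀ z : Ambient n, collarRadius z = radiusFun ‖z‖ := fun z => rfl
  simp only [hrad]
  rw [h1, h2, hFy, hLy, hny, radiusFun_collar hr]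
  have hrC : (r : ℂ) ≠ 0 := by exact_mod_cast hr0
  have h2r : (2 + r : ℂ) ≠ 0 := by
    have : 2 + r ≠ 0 := by linarith [hr.1]
    exact_mod_cast this
  have h2r' : (2 - r : ℂ) ≠ 0 := by
    have : 2 - r ≠ 0 := by linarith [hr.2]
    exact_mod_cast this
  have hqC : (q : ℂ) = (2 - r) / (2 + r) := by
    rw [hq]
    push_cast
    rfl
  have h1q : (1 + (q : ℂ)) = 4 / (2 + r) := by
    rw [hqC]
    field_simp
    ring
  have h1q2 : (1 - (q : ℂ) ^ 2) = 8 * r / (2 + r) ^ 2 := by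
    rw [hqC]
    field_simp
    ring
  push_cast
  -- The shifted exponents κ-1 and κ-2 become divisions by r; with r^κ made opaque, a rational
  -- identity in r is left.
  rw [Complex.cpow_sub _ _ hrC, Complex.cpow_sub _ _ hrC, Complex.cpow_one, h1q, h1q2, hqC]
  generalize (r : ℂ) ^ κ = P
  generalize (r : ℂ) = x at *
  generalize sphereLaplacian f θ = s
  generalize f θ = t
  field_simp
  ring

/-- The indicial polynomial `k (2 lam + k - n)`. -/
def indicial (n : ℕ) (lam : ℂ) (k : ℕ) : ℂ := k * (2 * lam + k - n)

open Polynomial in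
/-- The polynomial `r^{-lam} (1 - r²/4)² (Δ + lam (n - lam)) ∑ r^{lam+k} a_k`. -/
def residualPoly (lam : ℂ) (K : ℕ) (a : ℕ → SmoothFun n) (θ : Sph n) : Polynomial ℂ :=
  ∑ k ∈ Finset.range (K + 1),
    -- At κ = λ+k the factor κ(κ-n) + λ(n-λ) is the indicial polynomial. The three powers come from
    -- (1-r²/4)² = 1 - r²/2 + r⁴/16 and r²(1-r²/4).
    (C (indicial n lam k * a k θ) * X ^ k +
      C (sphereLaplacian (a k) θ - (indicial n lam k / 2 + n * (lam + k) / 2) * a k θ) *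
        X ^ (k + 2) +
      C ((indicial n lam k / 16 + n * (lam + k) / 8) * a k θ) * X ^ (k + 4))

lemma contDiffAt_expansion_term (f : SmoothFun n) (κ : ℂ) {y : Ambient n} (hy : y ≠ 0)
    (hy1 : ‖y‖ < 1) :
    ContDiffAt ℝ ∞ (fun z => ((collarRadius z : ℝ) : ℂ) ^ κ * radialExtension f z) y := by
  refine ContDiffAt.mul ?_ (contDiffAt_radialExtension f hy)
  have hpos : 0 < collarRadius y := radiusFun_pos ⟨norm_pos_iff.2 hy, hy1⟩
  have h1 : ContDiffAt ℝ ∞ (fun z : Ambient n => (collarRadius z : ℝ)) y := by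
    unfold collarRadius
    have hn := contDiffAt_norm (n := ∞) ℝ hy
    refine (contDiffAt_const.mul (contDiffAt_const.sub hn)).div (contDiffAt_const.add hn) ?_
    linarith [norm_nonneg y]
  have h2 : ContDiffAt ℝ ∞ (fun z : Ambient n => ((collarRadius z : ℝ) : ℂ)) y :=
    Complex.ofRealCLM.contDiff.contDiffAt.comp y h1
  have h3 : ContDiffAt ℂ ∞ (fun z : ℂ => z ^ κ) ((collarRadius y : ℝ) : ℂ) :=
    (analyticAt_id.cpow analyticAt_const (Complex.ofReal_mem_slitPlane.2 hpos)).contDiffAt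
  exact (h3.restrict_scalars ℝ).comp y h2

lemma expansion_equation (hn : 1 ≤ n) (lam : ℂ) (K : ℕ) (a : ℕ → SmoothFun n) (θ : Sph n)
    {r : ℝ} (hr : r ∈ Set.Ioo (0 : ℝ) 2) :
    (laplaceBeltrami (poincareMetric n) (expansion lam K a) (collar n (r, (θ : Ambient n))) +
        lam * ((n : ℂ) - lam) * expansion lam K a (collar n (r, (θ : Ambient n)))) *
        (1 - (r : ℂ) ^ 2 / 4) ^ 2 =
      (r : ℂ) ^ lam * (residualPoly lam K a θ).eval (r : ℂ) := by
  set y := collar n (r, (θ : Ambient n)) with hy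
  have hny : ‖y‖ = (2 - r) / (2 + r) := norm_collar hr θ
  have hy1 : ‖y‖ < 1 := by
    rw [hny, div_lt_one (by linarith [hr.1])]
    linarith [hr.1]
  have hy0 : y ≠ 0 := by
    rw [← norm_pos_iff, hny]
    exact div_pos (by linarith [hr.2]) (by linarith [hr.1])
  have hrC : (r : ℂ) ≠ 0 := by exact_mod_cast hr.1.ne'
  let u : ℕ → Ambient n → ℂ := fun k z =>
    ((collarRadius z : ℝ) : ℂ) ^ (lam + (k : ℂ)) * radialExtension (a k) z
  have hu : ∀ k, ∀ z : Ambient n, z ≠ 0 → ‖z‖ < 1 → ContDiffAt ℝ ∞ (u k) z := fun k z hz hz1 =>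
    contDiffAt_expansion_term (a k) _ hz hz1
  have hexp : expansion lam K a = fun z => ∑ k ∈ Finset.range (K + 1), u k z := rfl
  have hpd : ∀ z : Ambient n, z ≠ 0 → ‖z‖ < 1 → ∀ b, pd b (expansion lam K a) z =
      ∑ k ∈ Finset.range (K + 1), pd b (u k) z := by
    intro z hz hz1 b
    rw [hexp, pd, fderiv_fun_sum fun k _ => differentiableAt_of_contDiffAt_infty (hu k z hz hz1)]
    simp [pd]
  have hpd2 : ∀ b, pd b (pd b (expansion lam K a)) y =
      ∑ k ∈ Finset.range (K + 1), pd b (pd b (u k)) y := by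
    intro b
    have hev : pd b (expansion lam K a) =ᶠ[𝓝 y]
        fun z => ∑ k ∈ Finset.range (K + 1), pd b (u k) z := by
      filter_upwards [eventually_ne_zero hy0, eventually_norm_lt_one hy1] with z hz hz1
      exact hpd z hz hz1 b
    rw [pd_congr hev, pd, fderiv_fun_sum fun k _ =>
      differentiableAt_of_contDiffAt_infty (contDiffAt_pd (hu k y hy0 hy1) b)]
    simp [pd]
  have hsm : ContDiffAt ℝ ∞ (expansion lam K a) y := by
    rw [hexp]
    exact ContDiffAt.sum fun k _ => hu k y hy0 hy1
  have hlap : euclideanLaplacian (expansion lam K a) y =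
      ∑ k ∈ Finset.range (K + 1), euclideanLaplacian (u k) y := by
    unfold euclideanLaplacian
    simp only [hpd2]
    rw [Finset.sum_comm]
  have hrad : ∑ b, (y b : ℂ) * pd b (expansion lam K a) y =
      ∑ k ∈ Finset.range (K + 1), ∑ b, (y b : ℂ) * pd b (u k) y := by
    simp only [hpd y hy0 hy1, Finset.mul_sum]
    rw [Finset.sum_comm]
  rw [laplaceBeltrami_poincareMetric hn hy1 hsm, hlap, hrad, hexp, Finset.mul_sum, Finset.mul_sum,
    ← Finset.sum_add_distrib, Finset.mul_sum, ← Finset.sum_add_distrib, Finset.sum_mul,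
    residualPoly, Polynomial.eval_finsetSum, Finset.mul_sum]
  refine Finset.sum_congr rfl fun k _ => ?_
  rw [collar_term (a k) lam (lam + k) hr θ hy, Complex.cpow_add _ _ hrC, Complex.cpow_natCast]
  simp only [Polynomial.eval_add, Polynomial.eval_mul, Polynomial.eval_C, Polynomial.eval_pow,
    Polynomial.eval_X, indicial]
  ring

/-- On (0,1) the factor (1-r²/4)² lies between 1/4 and 1, and |r^λ| = r^{Re λ}, so both can be
removed up to constants. -/
lemma isBigO_cpow_iff_X_pow_dvd {F : ℝ → ℂ} (p : Polynomial ℂ) (lam : ℂ) (K : ℕ)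
    (h : ∀ r ∈ Set.Ioo (0 : ℝ) 2,
      F r * (1 - (r : ℂ) ^ 2 / 4) ^ 2 = (r : ℂ) ^ lam * p.eval (r : ℂ)) :
    F =O[𝓝[>] (0 : ℝ)] (fun r : ℝ => r ^ (lam.re + (K : ℝ) + 1)) ↔
      Polynomial.X ^ (K + 1) ∣ p := by
  rw [X_pow_dvd_iff_isBigO]
  have hmem : Set.Ioo (0 : ℝ) 1 ∈ 𝓝[>] (0 : ℝ) := Ioo_mem_nhdsGT one_pos
  have hnorm : ∀ r ∈ Set.Ioo (0 : ℝ) 1, ‖F r‖ * (1 - r ^ 2 / 4) ^ 2 =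
      r ^ lam.re * ‖p.eval (r : ℂ)‖ := by
    intro r hr
    have h1 := congrArg norm (h r ⟨hr.1, by linarith [hr.2]⟩)
    have h2 : (1 - (r : ℂ) ^ 2 / 4) = ((1 - r ^ 2 / 4 : ℝ) : ℂ) := by push_cast; ring
    rw [norm_mul, norm_mul, Complex.norm_cpow_eq_rpow_re_of_pos hr.1, h2, norm_pow,
      Complex.norm_real, Real.norm_eq_abs, sq_abs] at h1
    exact h1
  have hrpow : ∀ r ∈ Set.Ioo (0 : ℝ) 1,
      ‖r ^ (lam.re + (K : ℝ) + 1)‖ = r ^ lam.re * ‖r ^ (K + 1)‖ := by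
    intro r hr
    rw [Real.norm_of_nonneg (Real.rpow_nonneg hr.1.le _),
      Real.norm_of_nonneg (pow_nonneg hr.1.le _), add_assoc, Real.rpow_add hr.1,
      ← Real.rpow_natCast r (K + 1)]
    push_cast
    rfl
  rw [Asymptotics.isBigO_iff, Asymptotics.isBigO_iff]
  constructor
  · rintro ⟨c, hc⟩
    refine ⟨c, ?_⟩
    filter_upwards [hc, hmem] with r hr hr1
    have hpos : 0 < r ^ lam.re := Real.rpow_pos_of_pos hr1.1 _
    rw [hrpow r hr1] at hr
    refine le_of_mul_le_mul_left ?_ hpos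
    rw [← hnorm r hr1]
    have hle : (1 - r ^ 2 / 4) ^ 2 ≤ 1 :=
      pow_le_one₀ (by nlinarith [hr1.1, hr1.2]) (by nlinarith [hr1.1, hr1.2])
    calc ‖F r‖ * (1 - r ^ 2 / 4) ^ 2 ≤ ‖F r‖ * 1 := by gcongr
      _ ≤ r ^ lam.re * (c * ‖r ^ (K + 1)‖) := by linarith
  · rintro ⟨c, hc⟩
    refine ⟨4 * c, ?_⟩
    filter_upwards [hc, hmem] with r hr hr1
    have hpos : 0 < r ^ lam.re := Real.rpow_pos_of_pos hr1.1 _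
    rw [hrpow r hr1]
    have hge : 1 / 4 ≤ (1 - r ^ 2 / 4) ^ 2 := by nlinarith [hr1.1, hr1.2]
    have h1 : ‖F r‖ * (1 / 4) ≤ ‖F r‖ * (1 - r ^ 2 / 4) ^ 2 := by gcongr
    rw [hnorm r hr1] at h1
    have h2 := mul_le_mul_of_nonneg_left hr hpos.le
    linarith

/-- The coefficient recursion of a formal solution. -/
def recursionResidual (lam : ℂ) (a : ℕ → SmoothFun n) (θ : Sph n) (m : ℕ) : ℂ :=
  indicial n lam m * a m θ +
    (if 2 ≤ m then sphereLaplacian (a (m - 2)) θ -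
      (indicial n lam (m - 2) / 2 + n * (lam + (m - 2 : ℕ)) / 2) * a (m - 2) θ else 0) +
    (if 4 ≤ m then
      (indicial n lam (m - 4) / 16 + n * (lam + (m - 4 : ℕ)) / 8) * a (m - 4) θ else 0)

lemma sum_ite_add_eq (K m d : ℕ) (hm : m ≤ K) (c : ℕ → ℂ) :
    ∑ k ∈ Finset.range (K + 1), (if m = k + d then c k else 0) =
      if d ≤ m then c (m - d) else 0 := by
  split_ifs with h
  · rw [Finset.sum_eq_single (m - d)]
    · rw [if_pos (by omega)]
    · intro b _ hb
      rw [if_neg (by omega)]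
    · intro hb
      exact absurd (Finset.mem_range.2 (by omega)) hb
  · exact Finset.sum_eq_zero fun k _ => if_neg (by omega)

/-- Cutting the expansion at K only affects coefficients of degree above K. -/
lemma residualPoly_coeff (lam : ℂ) (K : ℕ) (a : ℕ → SmoothFun n) (θ : Sph n) (m : ℕ)
    (hm : m ≤ K) : (residualPoly lam K a θ).coeff m = recursionResidual lam a θ m := by
  have h0 := sum_ite_add_eq K m 0 hm fun k => indicial n lam k * a k θ
  simp only [add_zero, Nat.zero_le, if_true, Nat.sub_zero] at h0
  simp only [residualPoly, Polynomial.finsetSum_coeff, Polynomial.coeff_add,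
    Polynomial.coeff_C_mul, Polynomial.coeff_X_pow, mul_ite, mul_one, mul_zero,
    Finset.sum_add_distrib]
  rw [h0, sum_ite_add_eq K m 2 hm, sum_ite_add_eq K m 4 hm]
  rfl

theorem isFormalSolution_iff (hn : 1 ≤ n) (lam : ℂ) (K : ℕ) (a : ℕ → SmoothFun n) :
    IsFormalSolution lam K a ↔ ∀ θ, ∀ m ≤ K, recursionResidual lam a θ m = 0 := by
  refine forall_congr' fun θ => ?_
  rw [isBigO_cpow_iff_X_pow_dvd (residualPoly lam K a θ) lam K fun r hr =>
    expansion_equation hn lam K a θ hr, Polynomial.X_pow_dvd_iff]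
  exact ⟨fun h m hm => residualPoly_coeff lam K a θ m hm ▸ h m (by omega),
    fun h m hm => (residualPoly_coeff lam K a θ m (by omega)).trans (h m (by omega))⟩

/-! ### The solution operators and their adjoints -/

/-- The pair `(T_{2j}, T_{2j-2})` of consecutive solution operators applied to `f`. -/
def solutionPair (lam : ℂ) (f : SmoothFun n) : ℕ → SmoothFun n × SmoothFun n
  | 0 => (f, constFun n 0)
  | j + 1 =>
    let p := solutionPair lam f j
    (smulFun (-(indicial n lam (2 * (j + 1)))⁻¹)
      (sphereLaplacian p.1 +
        smulFun (-(indicial n lam (2 * j) / 2 + n * (lam + (2 * j : ℕ)) / 2)) p.1 +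
        -- At j = 0 the truncated j - 1 is harmless because `p.2` is then the zero function.
        smulFun (indicial n lam (2 * (j - 1)) / 16 + n * (lam + (2 * (j - 1) : ℕ)) / 8) p.2), p.1)

/-- The solution operator `T_{2j}(lam)`. -/
def solutionOp (lam : ℂ) (j : ℕ) (f : SmoothFun n) : SmoothFun n := (solutionPair lam f j).1

lemma solutionOp_zero (lam : ℂ) (f : SmoothFun n) : solutionOp lam 0 f = f := rfl

lemma solutionOp_one (lam : ℂ) (f : SmoothFun n) : solutionOp lam 1 f =
    smulFun (-(indicial n lam (2 * (0 + 1)))⁻¹) (sphereLaplacian f +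
        smulFun (-(indicial n lam (2 * 0) / 2 + n * (lam + (2 * 0 : ℕ)) / 2)) f) := by
  refine smoothFun_ext fun θ => ?_
  simp [solutionOp, solutionPair]

lemma solutionOp_add_two (lam : ℂ) (j : ℕ) (f : SmoothFun n) : solutionOp lam (j + 2) f =
    smulFun (-(indicial n lam (2 * (j + 2)))⁻¹) (sphereLaplacian (solutionOp lam (j + 1) f) +
        smulFun (-(indicial n lam (2 * (j + 1)) / 2 + n * (lam + (2 * (j + 1) : ℕ)) / 2))
          (solutionOp lam (j + 1) f) +
        smulFun (indicial n lam (2 * j) / 16 + n * (lam + (2 * j : ℕ)) / 8)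
          (solutionOp lam j f)) := rfl

/-- Induction along the three-term recursion. -/
lemma twoStep_induction {P : ℕ → Prop} (h0 : P 0) (h1 : P 1)
    (h2 : ∀ j, P j → P (j + 1) → P (j + 2)) (j : ℕ) : P j := by
  have h : P j ∧ P (j + 1) := by
    induction j with
    | zero => exact ⟨h0, h1⟩
    | succ j ih => exact ⟨ih.2, h2 j ih.1 ih.2⟩
  exact h.1

/-- The operators are polynomials in the Laplacian. Adjoints reverse compositions, so this
commutation is what makes them self-adjoint. -/
lemma solutionOp_sphereLaplacian (lam : ℂ) (j : ℕ) (f : SmoothFun n) :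
    solutionOp lam j (sphereLaplacian f) = sphereLaplacian (solutionOp lam j f) := by
  induction j using twoStep_induction with
  | h0 => rfl
  | h1 => simp only [solutionOp_one, sphereLaplacian_smulFun, sphereLaplacian_add]
  | h2 j ih1 ih2 =>
    simp only [solutionOp_add_two, sphereLaplacian_smulFun, sphereLaplacian_add, ih1, ih2]

lemma isFormalAdjoint_smulFun {A B : SmoothFun n → SmoothFun n} (c : ℂ)
    (h : IsFormalAdjoint A B) :
    IsFormalAdjoint (fun f => smulFun c (A f)) (fun f => smulFun c (B f)) := by
  intro f φ
  simp only [smulFun_apply, mul_assoc, mul_left_comm _ c]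
  rw [MeasureTheory.integral_const_mul, MeasureTheory.integral_const_mul, h f φ]

lemma isFormalAdjoint_add {A B A' B' : SmoothFun n → SmoothFun n}
    (h : IsFormalAdjoint A B) (h' : IsFormalAdjoint A' B') :
    IsFormalAdjoint (fun f => A f + A' f) (fun f => B f + B' f) := by
  intro f φ
  simp only [add_fun_apply, add_mul, mul_add]
  rw [MeasureTheory.integral_add (smoothFun_integrable _ _) (smoothFun_integrable _ _),
    MeasureTheory.integral_add (smoothFun_integrable _ _) (smoothFun_integrable _ _), h f φ, h' f φ]

lemma isFormalAdjoint_comp {A B A' B' : SmoothFun n → SmoothFun n}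
    (h : IsFormalAdjoint A B) (h' : IsFormalAdjoint A' B') :
    IsFormalAdjoint (fun f => A (A' f)) (fun f => B' (B f)) :=
  fun f φ => (h (A' f) φ).trans (h' f (B φ))

lemma isFormalAdjoint_id : IsFormalAdjoint (fun f : SmoothFun n => f) fun f => f :=
  fun _ _ => rfl

/-- The solution operators are formally self-adjoint. -/
theorem isFormalAdjoint_solutionOp (lam : ℂ) (j : ℕ) :
    IsFormalAdjoint (solutionOp (n := n) lam j) (solutionOp lam j) := by
  induction j using twoStep_induction with
  | h0 => exact isFormalAdjoint_id
  | h1 =>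
    have h := isFormalAdjoint_smulFun (-(indicial n lam (2 * (0 + 1)))⁻¹)
      (isFormalAdjoint_add (isFormalAdjoint_sphereLaplacian (n := n)) (isFormalAdjoint_smulFun
        (-(indicial n lam (2 * 0) / 2 + n * (lam + (2 * 0 : ℕ)) / 2)) isFormalAdjoint_id))
    have e : solutionOp (n := n) lam 1 = _ := funext fun f => solutionOp_one lam f
    rwa [← e] at h
  | h2 j ih1 ih2 =>
    have hΔ : IsFormalAdjoint (fun f : SmoothFun n => sphereLaplacian (solutionOp lam (j + 1) f))
        fun f => sphereLaplacian (solutionOp lam (j + 1) f) := by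
      have h := isFormalAdjoint_comp isFormalAdjoint_sphereLaplacian ih2
      simpa only [solutionOp_sphereLaplacian] using h
    have h := isFormalAdjoint_smulFun (-(indicial n lam (2 * (j + 2)))⁻¹)
      (isFormalAdjoint_add (isFormalAdjoint_add hΔ (isFormalAdjoint_smulFun
        (-(indicial n lam (2 * (j + 1)) / 2 + n * (lam + (2 * (j + 1) : ℕ)) / 2)) ih2))
        (isFormalAdjoint_smulFun (indicial n lam (2 * j) / 16 + n * (lam + (2 * j : ℕ)) / 8) ih1))
    have e : solutionOp (n := n) lam (j + 2) = _ := funext fun f => solutionOp_add_two lam j f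
    rwa [← e] at h

/-- The pairing is bilinear, so g = Bφ - B'φ is tested against its conjugate: ∫|g|² = 0, and a
continuous g vanishes because the measure charges open sets. -/
lemma isFormalAdjoint_unique {A B B' : SmoothFun n → SmoothFun n} (h : IsFormalAdjoint A B)
    (h' : IsFormalAdjoint A B') : B = B' := by
  funext φ
  set g : SmoothFun n := B φ + smulFun (-1) (B' φ) with hg
  have hgθ : ∀ θ, g θ = B φ θ - B' φ θ := fun θ => by
    simp [hg]
    ring
  have h0 : ∫ θ, conjFun g θ * g θ ∂(sphereMeasure n) = 0 := by
    simp only [hgθ, mul_sub]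
    rw [MeasureTheory.integral_sub (smoothFun_integrable _ _) (smoothFun_integrable _ _),
      ← h, ← h', sub_self]
  have hcont : Continuous fun θ => ‖g θ‖ ^ 2 := g.contMDiff.continuous.norm.pow 2
  have h1 : ∫ θ, ‖g θ‖ ^ 2 ∂(sphereMeasure n) = 0 := by
    have e : ∀ θ, conjFun g θ * g θ = ((‖g θ‖ ^ 2 : ℝ) : ℂ) := fun θ => by
      rw [conjFun_apply, ← Complex.normSq_eq_conj_mul_self, Complex.normSq_eq_norm_sq]
    simp only [e] at h0
    rw [integral_complex_ofReal] at h0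
    exact_mod_cast h0
  have hint : MeasureTheory.Integrable (fun θ => ‖g θ‖ ^ 2) (sphereMeasure n) :=
    hcont.integrable_of_hasCompactSupport (HasCompactSupport.of_compactSpace _)
  rw [MeasureTheory.integral_eq_zero_iff_of_nonneg (fun θ => by positivity) hint] at h1
  have h2 := hcont.ae_eq_iff_eq (sphereMeasure n) continuous_const |>.1 h1
  refine smoothFun_ext fun θ => ?_
  have h3 : ‖g θ‖ ^ 2 = (0 : ℝ) := congrFun h2 θ
  rw [← sub_eq_zero, ← hgθ]
  simpa using h3

/-! ### Existence and even-order uniqueness of formal solutions -/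

lemma indicial_two_mul (lam : ℂ) (j : ℕ) :
    indicial n lam (2 * j) = 4 * (j * (lam - n / 2 + j)) := by
  unfold indicial
  push_cast
  ring

lemma recursionResidual_zero (lam : ℂ) (a : ℕ → SmoothFun n) (θ : Sph n) :
    recursionResidual lam a θ 0 = 0 := by
  simp [recursionResidual, indicial]

lemma recursionResidual_two (lam : ℂ) (a : ℕ → SmoothFun n) (θ : Sph n) :
    recursionResidual lam a θ (2 * (0 + 1)) = indicial n lam (2 * (0 + 1)) * a (2 * (0 + 1)) θ +
      (sphereLaplacian (a (2 * 0)) θ -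
        (indicial n lam (2 * 0) / 2 + n * (lam + (2 * 0 : ℕ)) / 2) * a (2 * 0) θ) := by
  simp [recursionResidual]

lemma recursionResidual_add_four (lam : ℂ) (a : ℕ → SmoothFun n) (θ : Sph n) (j : ℕ) :
    recursionResidual lam a θ (2 * (j + 2)) = indicial n lam (2 * (j + 2)) * a (2 * (j + 2)) θ +
      (sphereLaplacian (a (2 * (j + 1))) θ -
        (indicial n lam (2 * (j + 1)) / 2 + n * (lam + (2 * (j + 1) : ℕ)) / 2) *
          a (2 * (j + 1)) θ) +
      (indicial n lam (2 * j) / 16 + n * (lam + (2 * j : ℕ)) / 8) * a (2 * j) θ := by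
  have e1 : 2 * (j + 2) - 2 = 2 * (j + 1) := by omega
  have e2 : 2 * (j + 2) - 4 = 2 * j := by omega
  rw [recursionResidual, e1, e2, if_pos (by omega), if_pos (by omega)]

lemma eq_neg_inv_mul_iff {I x b : ℂ} (hI : I ≠ 0) : x = -I⁻¹ * b ↔ I * x + b = 0 := by
  constructor
  · rintro rfl
    field_simp
    ring
  · intro h
    field_simp
    linear_combination h

/-- Formal solutions are determined in even order by their leading coefficient. -/
lemma eq_solutionOp_of_recursion {lam : ℂ} {N : ℕ}
    (hI : ∀ j, 1 ≤ j → j ≤ N → indicial n lam (2 * j) ≠ 0) (a : ℕ → SmoothFun n)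
    (ha : ∀ θ, ∀ m ≤ 2 * N, recursionResidual lam a θ m = 0) (j : ℕ) :
    j ≤ N → a (2 * j) = solutionOp lam j (a 0) := by
  induction j using twoStep_induction with
  | h0 => exact fun _ => rfl
  | h1 =>
    intro hj
    refine smoothFun_ext fun θ => ?_
    have h := ha θ (2 * (0 + 1)) (by omega)
    rw [recursionResidual_two] at h
    rw [solutionOp_one, smulFun_apply, add_fun_apply, smulFun_apply]
    refine (eq_neg_inv_mul_iff (hI (0 + 1) le_rfl hj)).2 ?_
    linear_combination h
  | h2 j ih1 ih2 =>
    intro hj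
    have ih1 := ih1 (by omega)
    have ih2 := ih2 (by omega)
    refine smoothFun_ext fun θ => ?_
    have h := ha θ (2 * (j + 2)) (by omega)
    rw [recursionResidual_add_four, ih1, ih2] at h
    simp only [solutionOp_add_two, smulFun_apply, add_fun_apply]
    refine (eq_neg_inv_mul_iff (hI (j + 2) (by omega) hj)).2 ?_
    linear_combination h

/-- The coefficients of the formal solution with vanishing odd part. -/
def solutionCoeff (lam : ℂ) (f : SmoothFun n) (k : ℕ) : SmoothFun n :=
  if k % 2 = 0 then solutionOp lam (k / 2) f else constFun n 0

lemma solutionCoeff_two_mul (lam : ℂ) (f : SmoothFun n) (j : ℕ) :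
    solutionCoeff lam f (2 * j) = solutionOp lam j f := by
  simp [solutionCoeff]

lemma solutionCoeff_odd (lam : ℂ) (f : SmoothFun n) {k : ℕ} (hk : k % 2 = 1) :
    solutionCoeff lam f k = constFun n 0 := by
  simp [solutionCoeff, hk]

lemma recursionResidual_solutionCoeff {lam : ℂ} {N : ℕ}
    (hI : ∀ j, 1 ≤ j → j ≤ N → indicial n lam (2 * j) ≠ 0) (f : SmoothFun n) (θ : Sph n)
    (m : ℕ) (hm : m ≤ 2 * N) : recursionResidual lam (solutionCoeff lam f) θ m = 0 := by
  rcases Nat.even_or_odd' m with ⟨j, rfl | rfl⟩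
  · match j with
    | 0 => exact recursionResidual_zero _ _ _
    | 1 =>
      rw [recursionResidual_two, solutionCoeff_two_mul, solutionCoeff_two_mul, solutionOp_zero]
      have h := congrArg (fun g : SmoothFun n => g θ) (solutionOp_one lam f)
      simp only [smulFun_apply, add_fun_apply] at h
      have h' := (eq_neg_inv_mul_iff (hI (0 + 1) le_rfl (by omega))).1 h
      linear_combination h'
    | j + 2 =>
      rw [recursionResidual_add_four, solutionCoeff_two_mul, solutionCoeff_two_mul,
        solutionCoeff_two_mul]
      have h := congrArg (fun g : SmoothFun n => g θ) (solutionOp_add_two lam j f)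
      simp only [smulFun_apply, add_fun_apply] at h
      have h' := (eq_neg_inv_mul_iff (hI (j + 2) (by omega) (by omega))).1 h
      linear_combination h'
  · have h1 : ∀ d, 2 * d ≤ 2 * j + 1 → solutionCoeff lam f (2 * j + 1 - 2 * d) = constFun n 0 :=
      fun d hd => solutionCoeff_odd lam f (by omega)
    unfold recursionResidual
    rw [solutionCoeff_odd lam f (k := 2 * j + 1) (by omega)]
    have h2 : 2 ≤ 2 * j + 1 → solutionCoeff lam f (2 * j + 1 - 2) = constFun n 0 := h1 1
    have h4 : 4 ≤ 2 * j + 1 → solutionCoeff lam f (2 * j + 1 - 4) = constFun n 0 := h1 2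
    split_ifs with c2 c4 c4
    · rw [h2 c2, h4 c4, sphereLaplacian_constFun]
      simp
    · rw [h2 c2, sphereLaplacian_constFun]
      simp
    · omega
    · simp

/-- The solution operators applied to constants. -/
lemma solutionOp_constFun {lam : ℂ} {N : ℕ}
    (hlam : ∀ j < N, lam - (n : ℂ) / 2 + 1 + j ≠ 0) (c : ℂ) (j : ℕ) : j ≤ N →
    solutionOp lam j (constFun n c) = constFun n (c * (hypergeometricCoeff n lam j / 4 ^ j)) := by
  -- On constants the equation is divisible by 1 - r²/4, which leaves this two-term hypergeometric
  -- relation. The three-term recursion is recovered as the relation at j+1 minus a quarter of the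
  -- one at j.
  have hrec : ∀ j, j + 1 ≤ N → indicial n lam (2 * (j + 1)) *
      (c * (hypergeometricCoeff n lam (j + 1) / 4 ^ (j + 1))) =
      (indicial n lam (2 * j) / 4 + n * (lam + (2 * j : ℕ)) / 2) *
        (c * (hypergeometricCoeff n lam j / 4 ^ j)) := by
    intro j hj
    have h := hypergeometricCoeff_succ n lam j (hlam j (by omega))
    rw [indicial_two_mul, indicial_two_mul]
    push_cast
    rw [pow_succ]
    have h4 : (4 : ℂ) ^ j ≠ 0 := pow_ne_zero _ (by norm_num)
    field_simp
    linear_combination 2 * c * h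
  have hI : ∀ j, j + 1 ≤ N → indicial n lam (2 * (j + 1)) ≠ 0 := by
    intro j hj
    rw [indicial_two_mul]
    have h1 := hlam j (by omega)
    have h2 : ((j + 1 : ℕ) : ℂ) ≠ 0 := by exact_mod_cast Nat.succ_ne_zero j
    refine mul_ne_zero (by norm_num) (mul_ne_zero h2 ?_)
    push_cast
    convert h1 using 1
    ring
  induction j using twoStep_induction with
  | h0 =>
    intro _
    simp [solutionOp_zero, hypergeometricCoeff]
  | h1 =>
    intro hj
    refine smoothFun_ext fun θ => ?_
    rw [solutionOp_one, sphereLaplacian_constFun]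
    simp only [smulFun_apply, add_fun_apply, constFun_apply]
    refine ((eq_neg_inv_mul_iff (hI 0 hj)).2 ?_).symm
    have h := hrec 0 hj
    have h0 : indicial n lam (2 * 0) = 0 := by simp [indicial]
    have h1 : hypergeometricCoeff n lam 0 = 1 := by simp [hypergeometricCoeff]
    rw [h0, h1] at h
    rw [h0]
    linear_combination h
  | h2 j ih1 ih2 =>
    intro hj
    have ih1 := ih1 (by omega)
    have ih2 := ih2 (by omega)
    refine smoothFun_ext fun θ => ?_
    rw [solutionOp_add_two, ih1, ih2, sphereLaplacian_constFun]
    simp only [smulFun_apply, add_fun_apply, constFun_apply]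
    refine ((eq_neg_inv_mul_iff (hI (j + 1) hj)).2 ?_).symm
    linear_combination hrec (j + 1) hj - hrec j (by omega) / 4

lemma indicial_ne_zero {lam : ℂ} {N : ℕ} (hlam : ∀ j ∈ Finset.Icc 1 N, lam ≠ (n : ℂ) / 2 - (j : ℂ))
    (j : ℕ) (h1 : 1 ≤ j) (hN : j ≤ N) : indicial n lam (2 * j) ≠ 0 := by
  rw [indicial_two_mul]
  have h2 : (j : ℂ) ≠ 0 := by exact_mod_cast (by omega : j ≠ 0)
  refine mul_ne_zero (by norm_num) (mul_ne_zero h2 fun h => ?_)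
  exact hlam j (Finset.mem_Icc.2 ⟨h1, hN⟩) (by linear_combination h)

/-- The recursion never mixes parities. In odd order the indicial polynomial may vanish at an
allowed λ, so odd coefficients need not be unique, but the operators only read even ones. -/
lemma isSolutionOperators_iff (hn : 1 ≤ n) {N : ℕ} {lam : ℂ}
    (hlam : ∀ j ∈ Finset.Icc 1 N, lam ≠ (n : ℂ) / 2 - (j : ℂ))
    (T : ℕ → SmoothFun n → SmoothFun n) :
    IsSolutionOperators n N lam T ↔ ∀ j ≤ N, T j = solutionOp lam j := by
  have hI := indicial_ne_zero hlam
  constructor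
  · intro h j hj
    funext f
    obtain ⟨a, ha0, ha, haT⟩ := h f
    rw [isFormalSolution_iff hn] at ha
    rw [haT j hj, eq_solutionOp_of_recursion hI a ha j hj, ha0]
  · intro h f
    refine ⟨solutionCoeff lam f, solutionCoeff_two_mul lam f 0, ?_, fun j hj => ?_⟩
    · rw [isFormalSolution_iff hn]
      exact fun θ m hm => recursionResidual_solutionCoeff hI f θ m hm
    · rw [h j hj, solutionCoeff_two_mul]

end RoundSphere

end

theorem mainTheorem5 (n : ℕ) (hn : 1 ≤ n) :
    -- the Poincaré metric of the ball is an Einstein metric: `Ric(g_+) + n g_+ = 0`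
    (∀ y : RoundSphere.Ambient n, ‖y‖ < 1 → ∀ a b : Fin (n + 1),
      RoundSphere.ricci (RoundSphere.poincareMetric n) a b y +
        (n : ℝ) * RoundSphere.poincareMetric n y a b = 0) ∧
    -- on the collar `g_+ = r⁻² (dr² + h_r)` with `h_r = (1 - r²/4)² h`, `h` the round metric
    (∀ r ∈ Set.Ioo (0 : ℝ) 2, ∀ θ : RoundSphere.Sph n, ∀ s t : ℝ,
      ∀ a b : RoundSphere.Ambient n,
      inner ℝ (θ : RoundSphere.Ambient n) a = 0 → inner ℝ (θ : RoundSphere.Ambient n) b = 0 →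
      (RoundSphere.poincareMetric n).apply (RoundSphere.collar n (r, (θ : RoundSphere.Ambient n)))
          (fderiv ℝ (RoundSphere.collar n) (r, (θ : RoundSphere.Ambient n)) (s, a))
          (fderiv ℝ (RoundSphere.collar n) (r, (θ : RoundSphere.Ambient n)) (t, b)) =
        (r ^ 2)⁻¹ * (s * t + RoundSphere.sliceMetric n r (θ : RoundSphere.Ambient n) a b) ∧
      RoundSphere.sliceMetric n r (θ : RoundSphere.Ambient n) a b =
        (1 - r ^ 2 / 4) ^ 2 * inner ℝ a b) ∧
    ∀ (N : ℕ), 1 ≤ N → ∀ lam : ℂ, (∀ j ∈ Finset.Icc 1 N, lam ≠ (n : ℂ) / 2 - (j : ℂ)) →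
      -- the operators, their adjoints and the holographic coefficients exist
      (∃ (v : ℕ → RoundSphere.SmoothFun n)
          (T Tstar : ℕ → RoundSphere.SmoothFun n → RoundSphere.SmoothFun n),
        RoundSphere.IsHolographicCoefficients n N v ∧
        RoundSphere.IsSolutionOperators n N lam T ∧
        ∀ j ≤ N, RoundSphere.IsFormalAdjoint (T j) (Tstar j)) ∧
      -- the summation formula
      ∀ (v : ℕ → RoundSphere.SmoothFun n)
          (T Tstar : ℕ → RoundSphere.SmoothFun n → RoundSphere.SmoothFun n),
        RoundSphere.IsHolographicCoefficients n N v →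
        RoundSphere.IsSolutionOperators n N lam T →
        (∀ j ≤ N, RoundSphere.IsFormalAdjoint (T j) (Tstar j)) →
        ∀ θ : RoundSphere.Sph n,
          ∑ j ∈ Finset.range (N + 1), Tstar j (v (N - j)) θ =
            (-1 : ℂ) ^ N *
              ((ascPochhammer ℂ N).eval ((n : ℂ) / 2 - (N : ℂ) + 1) /
                ((2 : ℂ) ^ (2 * N) * (N.factorial : ℂ))) *
              (((lam - (n : ℂ) + 2 * (N : ℂ)) *
                  (ascPochhammer ℂ (N - 1)).eval (lam - (n : ℂ) + 1)) /
                (ascPochhammer ℂ N).eval (lam - (n : ℂ) / 2 + 1)) := by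
  refine ⟨fun y hy a b => RoundSphere.ricci_poincareMetric hy a b,
    fun r hr θ s t a b ha hb => ⟨RoundSphere.poincareMetric_collar hr θ s t a b ha hb,
      RoundSphere.sliceMetric_eq hr θ a b⟩, fun N hN lam hlam => ⟨?_, ?_⟩⟩
  · refine ⟨fun j => RoundSphere.constFun n ((n.choose j : ℂ) * (-1 / 4) ^ j),
      RoundSphere.solutionOp lam, RoundSphere.solutionOp lam, ?_, ?_,
      fun j _ => RoundSphere.isFormalAdjoint_solutionOp lam j⟩
    · rw [RoundSphere.isHolographicCoefficients_iff]
      exact fun j _ θ => rfl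
    · rw [RoundSphere.isSolutionOperators_iff hn hlam]
      exact fun _ _ => rfl
  · intro v T Tstar hv hT hTstar θ
    rw [RoundSphere.isHolographicCoefficients_iff] at hv
    rw [RoundSphere.isSolutionOperators_iff hn hlam] at hT
    have hlam' : ∀ j < N, lam - (n : ℂ) / 2 + 1 + j ≠ 0 := by
      intro j hj h
      refine hlam (j + 1) (Finset.mem_Icc.2 ⟨by omega, by omega⟩) ?_
      push_cast
      linear_combination h
    -- The powers 4^{-j} from the operator and 4^{-(N-j)} from v, both due to z = r²/4, combine to a
    -- factor independent of j.
    have hterm : ∀ j ∈ Finset.range (N + 1), Tstar j (v (N - j)) θ = (1 / 4) ^ N *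
        (RoundSphere.hypergeometricCoeff n lam j *
          ((-1) ^ (N - j) * (n.choose (N - j) : ℂ))) := by
      intro j hj
      have hj : j ≤ N := Nat.lt_succ_iff.1 (Finset.mem_range.1 hj)
      have h1 : Tstar j = RoundSphere.solutionOp lam j := by
        refine RoundSphere.isFormalAdjoint_unique (hTstar j hj) ?_
        rw [hT j hj]
        exact RoundSphere.isFormalAdjoint_solutionOp lam j
      have h2 : v (N - j) = RoundSphere.constFun n ((n.choose (N - j) : ℂ) * (-1 / 4) ^ (N - j)) :=
        RoundSphere.smoothFun_ext fun θ => hv (N - j) (Nat.sub_le N j) θ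
      rw [h1, h2, RoundSphere.solutionOp_constFun hlam' _ j hj, RoundSphere.constFun_apply]
      obtain ⟨k, rfl⟩ : ∃ k, N = j + k := ⟨N - j, by omega⟩
      rw [Nat.add_sub_cancel_left, pow_add, div_pow, one_div_pow, one_div_pow]
      ring
    rw [Finset.sum_congr rfl hterm, ← Finset.mul_sum,
      RoundSphere.sum_hypergeometricCoeff n hn lam N hN hlam', pow_mul, one_div_pow]
    norm_num
    ring
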